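/- Let $n\ge 1$ be an integer, $0<\beta<n$, $1<p_1,q_1,p_2,q_2<\infty$ and $\frac1{p_1}-\frac1{p_2}=\frac{\beta}{n}$. Let $\sigma$ be the surface measure on the unit sphere $S^{n-1}\subset\mathbb R^n$ (the counting measure on $\{-1,1\}$ if $n=1$), $\omega_n=\sigma(S^{n-1})$, and write $p'=\frac{p}{p-1}$ and $B(u,v)=\int_0^1t^{u-1}(1-t)^{v-1}\,dt$. For measurable $f$ on $\mathbb R^n$ (real- or complex-valued) put $$\|f\|_{L^{p}_{rad}L^{q}_{ang}}=\Big(\int_0^\infty\Big(\int_{S^{n-1}}|f(r\theta)|^{q}\,d\sigma(\theta)\Big)^{p/q}r^{n-1}\,dr\Big)^{1/p},$$ and let $L^{p}_{rad}L^{q}_{ang}(\mathbb R^n)$ be the space of those $f$ for which this is finite. The fractional Hardy operator is $$H_\beta f(x)=\frac{1}{|B(0,|x|)|^{1-\beta/n}}\int_{|y|\le|x|}f(y)\,dy,\qquad x\in\mathbb R^n\setminus\{0\},$$ where $|B(0,|x|)|$ is the Lebesgue measure of the ball of radius $|x|$ about $0$. Then $H_\beta$ maps $L^{p_1}_{rad}L^{q_1}_{ang}(\mathbb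 R^n)$ to $L^{p_2}_{rad}L^{q_2}_{ang}(\mathbb R^n)$, and its operator norm, that is, the least $C$ with $\|H_\beta f\|_{L^{p_2}_{rad}L^{q_2}_{ang}}\le C\|f\|_{L^{p_1}_{rad}L^{q_1}_{ang}}$ for all $f\in L^{p_1}_{rad}L^{q_1}_{ang}(\mathbb R^n)$, is $$\|H_\beta\|_{L^{p_1}_{rad}L^{q_1}_{ang}\to L^{p_2}_{rad}L^{q_2}_{ang}}=\omega_n^{\frac1{q_2}-\frac1{q_1}+\frac{\beta}{n}}\Big(\frac{p_1'}{p_2}\Big)^{1/p_2}\Big[\frac{n}{p_2\beta}\,B\Big(\frac{n}{p_2\beta},\frac{n}{p_2'\beta}\Big)\Big]^{-\beta/n}.$$ The norm has the same value if only nonnegative $f$ are admitted. -/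

import Mathlib

open MeasureTheory Set
open scoped ENNReal

/-- The surface measure `σ` on the unit sphere `S^{n-1}` of `ℝⁿ` (for `n = 1`, the counting
measure on `{-1, 1}`). -/
noncomputable def sphereMeasure (n : ℕ) :
    Measure (Metric.sphere (0 : EuclideanSpace ℝ (Fin n)) 1) :=
  (volume : Measure (EuclideanSpace ℝ (Fin n))).toSphere

/-- `ω_n`, the surface area of the unit sphere `S^{n-1}`. -/
noncomputable def sphereArea (n : ℕ) : ℝ :=
  (sphereMeasure n).real univ

/-- The angular norm `‖f(r ·)‖_{L^q(S^{n-1})}`. -/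
noncomputable def angNorm {n : ℕ} {𝕜 : Type*} [RCLike 𝕜] (q : ℝ)
    (f : EuclideanSpace ℝ (Fin n) → 𝕜) (r : ℝ) : ℝ≥0∞ :=
  (∫⁻ θ : Metric.sphere (0 : EuclideanSpace ℝ (Fin n)) 1,
    ‖f (r • (θ : EuclideanSpace ℝ (Fin n)))‖ₑ ^ q ∂(sphereMeasure n)) ^ (1 / q)

/-- The mixed radial-angular norm
`‖f‖ = (∫_0^∞ ‖f(r ·)‖_{L^q(S^{n-1})}^p r^{n-1} dr)^{1/p}`, with values in `[0, ∞]`. -/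
noncomputable def radAngNorm {n : ℕ} {𝕜 : Type*} [RCLike 𝕜] (p q : ℝ)
    (f : EuclideanSpace ℝ (Fin n) → 𝕜) : ℝ≥0∞ :=
  (∫⁻ r in Ioi (0 : ℝ), angNorm q f r ^ p * ENNReal.ofReal (r ^ (n - 1))) ^ (1 / p)

/-- The mixed radial-angular space `L^p_rad L^q_ang(ℝⁿ)`: the (almost everywhere) measurable
functions of finite mixed norm. -/
def radAngSpace (n : ℕ) (𝕜 : Type*) [RCLike 𝕜] (p q : ℝ) :
    Set (EuclideanSpace ℝ (Fin n) → 𝕜) :=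
  {f | AEStronglyMeasurable f volume ∧ radAngNorm p q f < ∞}

/-- The fractional Hardy operator
`H_β f(x) = |B(0,|x|)|^{-(1 - β/n)} ∫_{|y| ≤ |x|} f(y) dy`. -/
noncomputable def fracHardy {n : ℕ} {𝕜 : Type*} [RCLike 𝕜] (β : ℝ)
    (f : EuclideanSpace ℝ (Fin n) → 𝕜) (x : EuclideanSpace ℝ (Fin n)) : 𝕜 :=
  (1 / volume.real (Metric.ball (0 : EuclideanSpace ℝ (Fin n)) ‖x‖) ^ (1 - β / n)) •
    ∫ y in {y : EuclideanSpace ℝ (Fin n) | ‖y‖ ≤ ‖x‖}, f y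

/-- The norm of an operator `T`, acting on the functions of the class `D`, from the norm of
`L^{p₁}_rad L^{q₁}_ang` to the norm of `L^{p₂}_rad L^{q₂}_ang`: the infimum of all `C ∈ [0, ∞]` with
`‖T f‖ ≤ C ‖f‖` for every `f ∈ D`. -/
noncomputable def radAngOpNorm {n : ℕ} {𝕜 : Type*} [RCLike 𝕜]
    (D : Set (EuclideanSpace ℝ (Fin n) → 𝕜))
    (T : (EuclideanSpace ℝ (Fin n) → 𝕜) → EuclideanSpace ℝ (Fin n) → 𝕜)
    (p₁ q₁ p₂ q₂ : ℝ) : ℝ≥0∞ :=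
  sInf {C : ℝ≥0∞ | ∀ f ∈ D, radAngNorm p₂ q₂ (T f) ≤ C * radAngNorm p₁ q₁ f}

/-- The beta function `B(u, v) = ∫_0^1 t^{u-1} (1-t)^{v-1} dt` for real `u, v > 0`. -/
noncomputable def eulerBeta (u v : ℝ) : ℝ :=
  ∫ t in (0 : ℝ)..1, t ^ (u - 1) * (1 - t) ^ (v - 1)

/-- The constant
`ω_n^{1/q₂ - 1/q₁ + β/n} (p₁'/p₂)^{1/p₂} [n/(p₂β) B(n/(p₂β), n/(p₂'β))]^{-β/n}`,
where `p' = p/(p-1)`. -/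
noncomputable def fracHardyConst (n : ℕ) (β p₁ q₁ p₂ q₂ : ℝ) : ℝ :=
  sphereArea n ^ (1 / q₂ - 1 / q₁ + β / n) *
    (Real.conjExponent p₁ / p₂) ^ (1 / p₂) *
    (n / (p₂ * β) *
      eulerBeta (n / (p₂ * β)) (n / (Real.conjExponent p₂ * β))) ^ (-(β / n))

open Filter Topology

/-! The transform `fracHardy β f` is radial, and the integral of `f` over a ball sees each sphere
only through its angular mean. Hölder on the sphere bounds that mean by the angular `L^{q₁}` norm,
with equality when `f` is radial. So the angular variables contribute only powers of `ω_n`, and a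
weighted one-dimensional Hardy inequality for the profile remains. The substitution `t = s^n` turns
it into Bliss's inequality for `∫ F^q x^(r-q) dx` in terms of `(∫ f^p)^(q/p)`, where `F` is the
primitive of `f`, `p = p₁`, `q = p₂`, `r = p₂β/n` and `q = p(r+1)`.

Bliss's inequality is proved by transport and calibration. With `ρ = (F/x)^q x^r`, let `Y(x)` be the
point at which `κ y^r (1+y^r)^(-q/r)` has on `(0, Y(x))` the mass that `ρ` has on `(0, x)`. The
quantity `E = F^(q-r) x^(-(q-r)/p') Y^(-r/p')` vanishes at the origin. Arithmetic-geometric mean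
bounds the negative part of `E'`, Young's inequality the positive part; integrating over `(0, R)`
and discarding `E(R) ≥ 0` gives the bound (`exp_log_calibration_le`,
`integral_blissDensity_le_aux`). For `f = (1+x^r)^(-(r+1)/r)` and `κ = 1` one has `Y = x` and both
inequalities are equalities, which is why the constant is sharp.

Approximation extends the bound from positive continuous functions to measurable ones
(`lintegral_bliss`). The radial function built from the extremal is nonnegative and attains equality
(`radAngNorm_fracHardy_hardyExtremal`), so restricting to nonnegative functions does not lower the
norm. The substitution `t = y^r/(1+y^r)` produces the beta function. -/

/-! ### The pointwise calibration inequality -/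

/-- The exponential is `E`, and it multiplies the logarithmic derivative of `E`, with the transport
equation already substituted for the derivative of `Y`. The terms in `x⁻¹` and `Y'/Y` are controlled
by arithmetic-geometric mean, the term in `f/F` by Young with `A`, `B` as normalising masses. -/
theorem exp_log_calibration_le {p p' q r κ A B f F x Y : ℝ} (hp : p.HolderConjugate p')
    (hr : 0 < r) (hq : q = p * (r + 1)) (hκ : 0 < κ) (hA : 0 < A) (hB : 0 < B) (hf : 0 ≤ f)
    (hF : 0 < F) (hx : 0 < x) (hY : 0 < Y) :
    Real.exp ((q - r) * Real.log F - (q - r) / p' * Real.log x - r / p' * Real.log Y) *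
        ((q - r) * (f / F) - (q - r) / p' * x⁻¹ -
          r / p' * (((F / x) ^ q * x ^ r / κ * (Y ^ r * (1 + Y ^ r) ^ (-(q / r)))⁻¹) / Y)) +
      q / p' * κ ^ (-(r / q)) * ((F / x) ^ q * x ^ r + (F / x) ^ q * x ^ r * Y ^ (-r)) ≤
    (q - r) * (A ^ (1 / p) * B ^ (1 / p')) *
      (f ^ p / (p * A) + (F / x) ^ q * x ^ r * Y ^ (-r) / (p' * B)) := by
  have hp0 := hp.pos
  have hp1 := hp.lt
  have hp'0 := hp.symm.pos
  have hpp : p' = p / (p - 1) := hp.conjugate_eq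
  have hp10 : 0 < p - 1 := by linarith
  have hqr : 0 < q - r := by rw [hq]; nlinarith
  have hq0 : 0 < q := by linarith
  set D := 1 + Y ^ r with hD
  have hD0 : 0 < D := by positivity
  set ρ := (F / x) ^ q * x ^ r with hρ
  have hρ0 : 0 < ρ := by positivity
  set Y' := ρ / κ * (Y ^ r * D ^ (-(q / r)))⁻¹ with hY'
  have hY'0 : 0 < Y' := by positivity
  set E := Real.exp ((q - r) * Real.log F - (q - r) / p' * Real.log x - r / p' * Real.log Y)
  -- arithmetic-geometric mean
  have h1 : x⁻¹ ^ (1 - r / q) * (Y' / Y) ^ (r / q) ≤ (1 - r / q) * x⁻¹ + r / q * (Y' / Y) := by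
    apply Real.geom_mean_le_arith_mean2_weighted <;> try positivity
    · rw [sub_nonneg, div_le_one hq0]; linarith
    · ring
  -- The weight `r/q` makes the powers match: `ρ^(r/q)` raises `F^(q-r)` to `F^q`, and
  -- `(D^(-q/r))⁻¹` becomes `D = 1 + Y^r`.
  have h2 : E * (x⁻¹ ^ (1 - r / q) * (Y' / Y) ^ (r / q)) = κ ^ (-(r / q)) * (ρ + ρ * Y ^ (-r)) := by
    have : ρ + ρ * Y ^ (-r) = ρ * Y ^ (-r) * D := by
      rw [hD, mul_add, mul_assoc _ _ (Y ^ r), ← Real.rpow_add hY]; simp; ring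
    rw [this, hY', hρ]
    clear_value D
    -- Writing every positive quantity as an exponential reduces an identity between real powers to
    -- a rational identity between exponents.
    obtain ⟨a, rfl⟩ : ∃ a, Real.exp a = x := ⟨_, Real.exp_log hx⟩
    obtain ⟨b, rfl⟩ : ∃ a, Real.exp a = F := ⟨_, Real.exp_log hF⟩
    obtain ⟨c, rfl⟩ : ∃ a, Real.exp a = Y := ⟨_, Real.exp_log hY⟩
    obtain ⟨d, rfl⟩ : ∃ a, Real.exp a = D := ⟨_, Real.exp_log hD0⟩
    obtain ⟨k, rfl⟩ : ∃ a, Real.exp a = κ := ⟨_, Real.exp_log hκ⟩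
    simp only [E, Real.log_exp, ← Real.exp_sub, ← Real.exp_add, ← Real.exp_mul, ← Real.exp_neg]
    congr 1
    rw [hpp, hq]
    field_simp
    ring
  have h3 : E * (f / F) = f * (ρ * Y ^ (-r)) ^ (1 / p') := by
    have : E / F = (ρ * Y ^ (-r)) ^ (1 / p') := by
      rw [hρ]
      obtain ⟨a, rfl⟩ : ∃ a, Real.exp a = x := ⟨_, Real.exp_log hx⟩
      obtain ⟨b, rfl⟩ : ∃ a, Real.exp a = F := ⟨_, Real.exp_log hF⟩
      obtain ⟨c, rfl⟩ : ∃ a, Real.exp a = Y := ⟨_, Real.exp_log hY⟩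
      simp only [E, Real.log_exp, ← Real.exp_sub, ← Real.exp_add, ← Real.exp_mul]
      congr 1
      rw [hpp, hq]
      field_simp
      ring
    rw [← this]; ring
  have h4 : f * (ρ * Y ^ (-r)) ^ (1 / p') ≤ (A ^ (1 / p) * B ^ (1 / p')) *
      (f ^ p / (p * A) + ρ * Y ^ (-r) / (p' * B)) := by
    have hG : 0 ≤ ρ * Y ^ (-r) := by positivity
    generalize ρ * Y ^ (-r) = G at hG
    have := Real.young_inequality_of_nonneg (a := f / A ^ (1 / p)) (b := (G / B) ^ (1 / p'))
      (by positivity) (by positivity) hp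
    rw [Real.div_rpow hf (by positivity), ← Real.rpow_mul hA.le, one_div_mul_cancel hp0.ne',
      Real.rpow_one, ← Real.rpow_mul (by positivity), one_div_mul_cancel hp'0.ne',
      Real.rpow_one, Real.div_rpow hG hB.le] at this
    calc _ = (A ^ (1 / p) * B ^ (1 / p')) * (f / A ^ (1 / p) * (G ^ (1 / p') / B ^ (1 / p'))) := by
          field_simp
      _ ≤ _ := by
          refine (mul_le_mul_of_nonneg_left this (by positivity)).trans (le_of_eq ?_)
          congr 1
          field_simp
  have h5 := mul_le_mul_of_nonneg_left h1 (show 0 ≤ q / p' * E by positivity)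
  have h6 : q / p' * E * (x⁻¹ ^ (1 - r / q) * (Y' / Y) ^ (r / q)) =
      q / p' * κ ^ (-(r / q)) * (ρ + ρ * Y ^ (-r)) := by
    rw [mul_assoc (q / p') E, h2]; ring
  have h7 : q / p' * E * ((1 - r / q) * x⁻¹ + r / q * (Y' / Y)) =
      E * ((q - r) / p' * x⁻¹ + r / p' * (Y' / Y)) := by
    field_simp
  have h8 := mul_le_mul_of_nonneg_left h4 hqr.le
  rw [← h3] at h8
  linear_combination h5 + h8 - h6 + h7

/-! ### The extremal kernels, their integrals and the transport map -/

/-- The kernel `(1 + y^r)^{-N}`, the `p`-th power of the Bliss extremal. -/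
noncomputable def blissTail (r N y : ℝ) : ℝ := (1 + y ^ r) ^ (-N)

/-- The kernel `y^r (1 + y^r)^{-N}`. -/
noncomputable def blissHead (r N y : ℝ) : ℝ := y ^ r * (1 + y ^ r) ^ (-N)

theorem blissTail_pos {r N y : ℝ} (hy : 0 ≤ y) : 0 < blissTail r N y := by
  unfold blissTail; positivity

theorem blissHead_pos {r N y : ℝ} (hy : 0 < y) : 0 < blissHead r N y := by
  unfold blissHead; positivity

theorem continuousOn_blissTail {r : ℝ} (N : ℝ) (hr : 0 < r) :
    ContinuousOn (blissTail r N) (Ici 0) := by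
  unfold blissTail
  refine ContinuousOn.rpow_const (by fun_prop (disch := exact hr.le)) fun y hy ↦ Or.inl ?_
  have : 0 ≤ y ^ r := Real.rpow_nonneg hy _
  positivity

theorem continuousOn_blissHead {r : ℝ} (N : ℝ) (hr : 0 < r) :
    ContinuousOn (blissHead r N) (Ici 0) :=
  (Real.continuous_rpow_const hr.le).continuousOn.mul (continuousOn_blissTail N hr)

theorem blissHead_le_rpow {r N y : ℝ} (hN : 0 ≤ N) (hy : 0 ≤ y) : blissHead r N y ≤ y ^ r := by
  have h : 0 ≤ y ^ r := Real.rpow_nonneg hy _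
  exact mul_le_of_le_one_right h (Real.rpow_le_one_of_one_le_of_nonpos (by linarith) (by linarith))

theorem integrableOn_Ioi_of_le_rpow {g : ℝ → ℝ} {a : ℝ} (ha : a < -1)
    (hg : ContinuousOn g (Ici 0)) (hg0 : ∀ y, 1 < y → 0 ≤ g y) (hle : ∀ y, 1 < y → g y ≤ y ^ a) :
    IntegrableOn g (Ioi 0) := by
  rw [← Ioc_union_Ioi_eq_Ioi (zero_le_one (α := ℝ))]
  refine IntegrableOn.union ?_ ?_
  · exact ((hg.mono Icc_subset_Ici_self).integrableOn_Icc).mono_set Ioc_subset_Icc_self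
  · refine (integrableOn_Ioi_rpow_of_lt ha one_pos).mono' ?_ ?_
    · exact (hg.mono (Ioi_subset_Ici zero_le_one)).aestronglyMeasurable measurableSet_Ioi
    · filter_upwards [ae_restrict_mem measurableSet_Ioi] with y hy
      rw [Real.norm_of_nonneg (hg0 y hy)]
      exact hle y hy

theorem blissTail_le_rpow {r N y : ℝ} (hN : 0 ≤ N) (hy : 0 < y) :
    blissTail r N y ≤ y ^ (-(r * N)) := by
  rw [← mul_neg, Real.rpow_mul hy.le]
  have h : 0 < y ^ r := Real.rpow_pos_of_pos hy _
  exact Real.rpow_le_rpow_of_nonpos h (by linarith) (by linarith)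

theorem integrableOn_blissTail {r N : ℝ} (hr : 0 < r) (hN0 : 0 ≤ N) (hN : 1 + r < r * N) :
    IntegrableOn (blissTail r N) (Ioi 0) :=
  integrableOn_Ioi_of_le_rpow (a := -(r * N)) (by linarith) (continuousOn_blissTail N hr)
    (fun y hy ↦ (blissTail_pos (by linarith)).le) (fun y hy ↦ blissTail_le_rpow hN0 (by linarith))

theorem integrableOn_blissHead {r N : ℝ} (hr : 0 < r) (hN0 : 0 ≤ N) (hN : 1 + r < r * N) :
    IntegrableOn (blissHead r N) (Ioi 0) := by
  refine integrableOn_Ioi_of_le_rpow (a := r - r * N) (by linarith) (continuousOn_blissHead N hr)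
    (fun y hy ↦ (blissHead_pos (by linarith)).le) (fun y hy ↦ ?_)
  have h0 : 0 < y := by linarith
  rw [sub_eq_add_neg, Real.rpow_add h0]
  exact mul_le_mul_of_nonneg_left (blissTail_le_rpow hN0 h0) (by positivity)

theorem intervalIntegrable_blissTail {r : ℝ} (N : ℝ) (hr : 0 < r) {a b : ℝ} (ha : 0 ≤ a)
    (hb : 0 ≤ b) : IntervalIntegrable (blissTail r N) volume a b :=
  ((continuousOn_blissTail N hr).mono fun _ h ↦ (le_min ha hb).trans h.1).intervalIntegrable

theorem intervalIntegrable_blissHead {r : ℝ} (N : ℝ) (hr : 0 < r) {a b : ℝ} (ha : 0 ≤ a)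
    (hb : 0 ≤ b) : IntervalIntegrable (blissHead r N) volume a b :=
  ((continuousOn_blissHead N hr).mono fun _ h ↦ (le_min ha hb).trans h.1).intervalIntegrable

theorem hasDerivAt_integral_of_continuousOn_Ici {g : ℝ → ℝ} (hg : ContinuousOn g (Ici 0)) {y : ℝ}
    (hy : 0 < y) : HasDerivAt (fun y ↦ ∫ t in 0..y, g t) (g y) y := by
  refine intervalIntegral.integral_hasDerivAt_right ?_ ?_ (hg.continuousAt (Ici_mem_nhds hy))
  · exact (hg.mono fun _ h ↦ (le_min le_rfl hy.le).trans h.1).intervalIntegrable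
  · exact (hg.mono Ioi_subset_Ici_self).stronglyMeasurableAtFilter isOpen_Ioi _ hy

/-- The primitive `∫_0^Y (1 + y^r)^{-N} (1 - (rN - r - 1) y^r) dy = Y (1 + Y^r)^{1-N}`. -/
theorem integral_blissTail_sub {r N Y : ℝ} (hr : 0 < r) (hY : 0 ≤ Y) :
    (∫ y in 0..Y, blissTail r N y) - (r * N - r - 1) * ∫ y in 0..Y, blissHead r N y =
      Y * (1 + Y ^ r) ^ (1 - N) := by
  rw [← intervalIntegral.integral_const_mul, ← intervalIntegral.integral_sub
    (intervalIntegrable_blissTail N hr le_rfl hY)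
    ((intervalIntegrable_blissHead N hr le_rfl hY).const_mul _)]
  rw [intervalIntegral.integral_eq_sub_of_hasDerivAt_of_le
    (f := fun y ↦ y * (1 + y ^ r) ^ (1 - N)) hY]
  · simp
  · refine continuousOn_id.mul (ContinuousOn.rpow_const (by fun_prop (disch := exact hr.le)) ?_)
    intro y hy
    have : 0 ≤ y ^ r := Real.rpow_nonneg hy.1 _
    exact Or.inl (by positivity)
  · intro y hy
    have hy0 : 0 < y := hy.1
    have h := (hasDerivAt_id y).mul
      (((Real.hasDerivAt_rpow_const (p := r) (Or.inl hy0.ne')).const_add 1).rpow_const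
        (p := 1 - N) (Or.inl (by positivity)))
    refine h.congr_deriv ?_
    have h1 : (1 + y ^ r) ^ (1 - N) = (1 + y ^ r) * (1 + y ^ r) ^ (-N) := by
      rw [sub_eq_add_neg, Real.rpow_add (by positivity), Real.rpow_one]
    have h2 : y ^ r = y * y ^ (r - 1) := by
      rw [Real.rpow_sub_one hy0.ne']; field_simp
    have h3 : 1 - N - 1 = -N := by ring
    rw [h3, h1, id, blissHead, blissTail]
    generalize (1 + y ^ r) ^ (-N) = w
    rw [h2]
    ring
  · exact (intervalIntegrable_blissTail N hr le_rfl hY).sub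
      ((intervalIntegrable_blissHead N hr le_rfl hY).const_mul _)

/-- The boundary term `Y (1 + Y^r)^(1-N)` of `integral_blissTail_sub` is at most `Y^(-(rN-r-1))`,
which vanishes at infinity. -/
theorem integral_Ioi_blissTail {r N : ℝ} (hr : 0 < r) (hN0 : 0 ≤ N) (hN : 1 + r < r * N) :
    ∫ y in Ioi 0, blissTail r N y = (r * N - r - 1) * ∫ y in Ioi 0, blissHead r N y := by
  have h0 := intervalIntegral_tendsto_integral_Ioi 0 (integrableOn_blissTail hr hN0 hN) tendsto_id
  have h1 := intervalIntegral_tendsto_integral_Ioi 0 (integrableOn_blissHead hr hN0 hN) tendsto_id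
  have h2 := h0.sub (h1.const_mul (r * N - r - 1))
  have h3 : Tendsto (fun Y : ℝ ↦ Y * (1 + Y ^ r) ^ (1 - N)) atTop (𝓝 0) := by
    have h4 : Tendsto (fun Y : ℝ ↦ Y ^ (-(r * N - r - 1))) atTop (𝓝 0) :=
      tendsto_rpow_neg_atTop (by linarith)
    refine tendsto_of_tendsto_of_tendsto_of_le_of_le' tendsto_const_nhds h4 ?_ ?_
    · filter_upwards [eventually_gt_atTop 0] with Y hY
      positivity
    · filter_upwards [eventually_gt_atTop 0] with Y hY
      have h5 : 0 < Y ^ r := Real.rpow_pos_of_pos hY _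
      have h6 : -(r * N - r - 1) = 1 + r * (1 - N) := by ring
      rw [h6, Real.rpow_add hY, Real.rpow_one, Real.rpow_mul hY.le]
      refine mul_le_mul_of_nonneg_left ?_ hY.le
      exact Real.rpow_le_rpow_of_nonpos h5 (by linarith) (by nlinarith)
  have h4 := tendsto_nhds_unique (h2.congr' ?_) h3
  · linarith
  · filter_upwards [eventually_ge_atTop 0] with Y hY
    exact integral_blissTail_sub hr hY

theorem integral_Ioi_blissHead_pos {r N : ℝ} (hr : 0 < r) (hN0 : 0 ≤ N) (hN : 1 + r < r * N) :
    0 < ∫ y in Ioi 0, blissHead r N y := by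
  rw [setIntegral_pos_iff_support_of_nonneg_ae _ (integrableOn_blissHead hr hN0 hN)]
  · refine lt_of_lt_of_le (b := volume (Ioi (0 : ℝ))) (by simp) (measure_mono fun y hy ↦ ?_)
    exact ⟨(blissHead_pos hy).ne', hy⟩
  · filter_upwards [ae_restrict_mem measurableSet_Ioi] with y hy
    exact (blissHead_pos hy).le

theorem intervalIntegral_le_integral_Ioi {g : ℝ → ℝ} (hg : IntegrableOn g (Ioi 0))
    (h0 : ∀ y, 0 < y → 0 ≤ g y) {Y : ℝ} (hY : 0 ≤ Y) :
    ∫ y in 0..Y, g y ≤ ∫ y in Ioi 0, g y := by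
  rw [intervalIntegral.integral_of_le hY]
  refine setIntegral_mono_set hg ?_ (Eventually.of_forall Ioc_subset_Ioi_self)
  filter_upwards [ae_restrict_mem measurableSet_Ioi] with y hy using h0 y hy

/-- The inverse function of `Y ↦ ∫_0^Y y^r (1 + y^r)^{-N} dy`. -/
theorem exists_inverse_integral_blissHead {r N : ℝ} (hr : 0 < r) (hN0 : 0 ≤ N)
    (hN : 1 + r < r * N) :
    ∃ Ψ : ℝ → ℝ, ∀ u ∈ Ioo 0 (∫ y in Ioi 0, blissHead r N y),
      0 < Ψ u ∧ ∫ y in 0..Ψ u, blissHead r N y = u ∧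
        HasDerivAt Ψ (blissHead r N (Ψ u))⁻¹ u := by
  set J : ℝ → ℝ := fun Y ↦ ∫ y in 0..Y, blissHead r N y with hJ
  set I := ∫ y in Ioi 0, blissHead r N y with hI
  have hderiv : ∀ y, 0 < y → HasDerivAt J (blissHead r N y) y := fun y hy ↦
    hasDerivAt_integral_of_continuousOn_Ici (continuousOn_blissHead N hr) hy
  have hcont : ContinuousOn J (Ici 0) := by
    intro y hy
    have hy1 : (0 : ℝ) ≤ y + 1 := by linarith [mem_Ici.1 hy]
    have := intervalIntegral.continuousOn_primitive_interval (a := 0) (b := y + 1) (μ := volume)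
      (f := blissHead r N)
      (by
        rw [uIcc_of_le hy1]
        exact ((continuousOn_blissHead N hr).mono Icc_subset_Ici_self).integrableOn_Icc)
    rw [uIcc_of_le hy1] at this
    refine (this y ⟨hy, by linarith⟩).mono_of_mem_nhdsWithin ?_
    rw [← Ici_inter_Iic]
    exact inter_mem self_mem_nhdsWithin (mem_nhdsWithin_of_mem_nhds (Iic_mem_nhds (by linarith)))
  have hmono : StrictMonoOn J (Ici 0) := by
    refine strictMonoOn_of_deriv_pos (convex_Ici 0) hcont fun y hy ↦ ?_
    rw [interior_Ici] at hy
    rw [(hderiv y hy).deriv]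
    exact blissHead_pos hy
  have hJ0 : J 0 = 0 := by simp [hJ]
  have hlim : Tendsto J atTop (𝓝 I) :=
    intervalIntegral_tendsto_integral_Ioi 0 (integrableOn_blissHead hr hN0 hN) tendsto_id
  have hlt : ∀ y, 0 ≤ y → J y < I := fun y hy ↦
    (hmono hy (show (0:ℝ) ≤ y + 1 by linarith) (by linarith)).trans_le
      (intervalIntegral_le_integral_Ioi (integrableOn_blissHead hr hN0 hN)
        (fun y hy ↦ (blissHead_pos hy).le) (by linarith))
  have hsurj : ∀ u ∈ Ioo 0 I, ∃ y, 0 < y ∧ J y = u := by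
    intro u hu
    obtain ⟨Z, hZu, hZ⟩ := ((hlim.eventually (lt_mem_nhds hu.2)).and (eventually_gt_atTop 0)).exists
    obtain ⟨y, hy, hyu⟩ := intermediate_value_Ioo hZ.le (hcont.mono Icc_subset_Ici_self)
      (show u ∈ Ioo (J 0) (J Z) from ⟨hJ0.trans_lt hu.1, hZu⟩)
    exact ⟨y, hy.1, hyu⟩
  choose! Ψ hΨ0 hΨ using hsurj
  refine ⟨Ψ, fun u hu ↦ ⟨hΨ0 u hu, hΨ u hu, ?_⟩⟩
  have hinv : ∀ y, 0 < y → J y ∈ Ioo 0 I ∧ Ψ (J y) = y := by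
    intro y hy
    have h1 : J y ∈ Ioo 0 I := ⟨hJ0 ▸ hmono (mem_Ici.2 le_rfl) hy.le hy, hlt y hy.le⟩
    exact ⟨h1, hmono.injOn (mem_Ici.2 (hΨ0 _ h1).le) (mem_Ici.2 hy.le) (hΨ _ h1)⟩
  have hnhds : Ioo 0 I ∈ 𝓝 u := isOpen_Ioo.mem_nhds hu
  have hΨmono : StrictMonoOn Ψ (Ioo 0 I) := by
    intro a ha b hb hab
    by_contra! h
    have := hmono.monotoneOn (mem_Ici.2 (hΨ0 b hb).le) (mem_Ici.2 (hΨ0 a ha).le) h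
    rw [hΨ a ha, hΨ b hb] at this
    linarith
  refine HasDerivAt.of_local_left_inverse (f := J) ?_ (hderiv _ (hΨ0 u hu))
    (blissHead_pos (hΨ0 u hu)).ne' ?_
  · refine hΨmono.continuousAt_of_image_mem_nhds hnhds ?_
    refine mem_of_superset (Ioi_mem_nhds (hΨ0 u hu)) fun y hy ↦ ?_
    exact ⟨J y, (hinv y hy).1, (hinv y hy).2⟩
  · filter_upwards [hnhds] with v hv using hΨ v hv

/-! ### Bliss's inequality for positive continuous functions -/

/-- The Bliss density `(F(x)/x)^q x^r`, where `F(x) = ∫_0^x f`. -/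
noncomputable def blissDensity (q r : ℝ) (f : ℝ → ℝ) (x : ℝ) : ℝ :=
  ((∫ t in 0..x, f t) / x) ^ q * x ^ r

theorem integral_bounds {f : ℝ → ℝ} (hf : Continuous f) {c C R x : ℝ}
    (hc : ∀ x ∈ Icc 0 R, c ≤ f x) (hC : ∀ x ∈ Icc 0 R, f x ≤ C) (hx : x ∈ Ioc 0 R) :
    c ≤ (∫ t in 0..x, f t) / x ∧ (∫ t in 0..x, f t) / x ≤ C := by
  rw [le_div_iff₀ hx.1, div_le_iff₀ hx.1]
  constructor
  · have := intervalIntegral.integral_mono_on hx.1.le (intervalIntegrable_const (μ := volume) (c := c))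
      (hf.intervalIntegrable 0 x) (fun y hy ↦ hc y ⟨hy.1, hy.2.trans hx.2⟩)
    simpa [mul_comm] using this
  · have := intervalIntegral.integral_mono_on hx.1.le (hf.intervalIntegrable 0 x)
      (intervalIntegrable_const (μ := volume) (c := C)) (fun y hy ↦ hC y ⟨hy.1, hy.2.trans hx.2⟩)
    simpa [mul_comm] using this

theorem integral_pos_of_pos {f : ℝ → ℝ} (hf : Continuous f) (hpos : ∀ x, 0 < f x) {x : ℝ}
    (hx : 0 < x) : 0 < ∫ t in 0..x, f t :=
  intervalIntegral.intervalIntegral_pos_of_pos (hf.intervalIntegrable 0 x) hpos hx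

theorem continuousOn_blissDensity {f : ℝ → ℝ} (hf : Continuous f) (hpos : ∀ x, 0 < f x) {q r : ℝ}
    (hq : 0 < q) (hr : 0 < r) : ContinuousOn (blissDensity q r f) (Ici 0) := by
  intro x hx
  rcases (mem_Ici.1 hx).eq_or_lt with rfl | hx
  · obtain ⟨C, hC⟩ := (isCompact_Icc (a := (0 : ℝ)) (b := 1)).bddAbove_image hf.continuousOn
    have hC' : ∀ x ∈ Icc (0 : ℝ) 1, f x ≤ C := fun x hx ↦ hC (mem_image_of_mem _ hx)
    have h0 : blissDensity q r f 0 = 0 := by simp [blissDensity, hr.ne']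
    rw [ContinuousWithinAt, h0]
    have h1 : Tendsto (fun x : ℝ ↦ C ^ q * x ^ r) (𝓝[≥] 0) (𝓝 0) := by
      have : Tendsto (fun x : ℝ ↦ C ^ q * x ^ r) (𝓝 0) (𝓝 (C ^ q * 0 ^ r)) :=
        ((Real.continuous_rpow_const hr.le).tendsto 0).const_mul _
      rw [Real.zero_rpow hr.ne', mul_zero] at this
      exact this.mono_left nhdsWithin_le_nhds
    refine tendsto_of_tendsto_of_tendsto_of_le_of_le' tendsto_const_nhds h1 ?_ ?_
    · filter_upwards [self_mem_nhdsWithin] with x hx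
      have hx : 0 ≤ x := hx
      have : 0 ≤ ∫ t in 0..x, f t := intervalIntegral.integral_nonneg hx fun t _ ↦ (hpos t).le
      unfold blissDensity; positivity
    · filter_upwards [self_mem_nhdsWithin, mem_nhdsWithin_of_mem_nhds (Iio_mem_nhds one_pos)]
        with x hx hx1
      rcases (mem_Ici.1 hx).eq_or_lt with rfl | hx
      · simp [h0, hr.ne']
      · have h2 := (integral_bounds hf (c := 0) (fun x _ ↦ (hpos x).le) hC' ⟨hx, (mem_Iio.1 hx1).le⟩)
        exact mul_le_mul_of_nonneg_right (Real.rpow_le_rpow h2.1 h2.2 hq.le) (by positivity)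
  · have h1 : ContinuousAt (fun x ↦ ∫ t in 0..x, f t) x :=
      (intervalIntegral.integral_hasDerivAt_right (hf.intervalIntegrable 0 x)
        hf.aestronglyMeasurable.stronglyMeasurableAtFilter hf.continuousAt).continuousAt
    refine ContinuousAt.continuousWithinAt (ContinuousAt.mul ?_ ?_)
    · exact (h1.div continuousAt_id hx.ne').rpow_const
        (Or.inr hq.le)
    · exact Real.continuousAt_rpow_const _ _ (Or.inl hx.ne')

/-- The transport argument. The strict bound on the mass of the density keeps `Y(R)` finite; the
sharp estimate appears when `κ` decreases to its critical value. -/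
theorem integral_blissDensity_le_aux {p p' q r κ R : ℝ} (hp : p.HolderConjugate p')
    (hr : 0 < r) (hq : q = p * (r + 1)) {f : ℝ → ℝ} (hf : Continuous f) (hpos : ∀ x, 0 < f x)
    (hR : 0 < R)
    (hκ : ∫ x in 0..R, blissDensity q r f x < κ * ∫ y in Ioi 0, blissHead r (q / r) y) :
    q / p' * κ ^ (-(r / q)) * ∫ x in 0..R, blissDensity q r f x ≤
      (∫ x in 0..R, f x ^ p) ^ (1 / p) *
        (κ * ∫ y in Ioi 0, blissTail r (q / r) y) ^ (1 / p') := by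
  have hp0 := hp.pos
  have hp1 := hp.lt
  have hp'0 := hp.symm.pos
  have hpp : p' = p / (p - 1) := hp.conjugate_eq
  have hp10 : 0 < p - 1 := by linarith
  have hqr : 0 < q - r := by rw [hq]; nlinarith
  have hq0 : 0 < q := by linarith
  have hN0 : 0 ≤ q / r := by positivity
  have hrN : r * (q / r) = q := by field_simp
  have hN : 1 + r < r * (q / r) := by rw [hrN, hq]; nlinarith
  obtain ⟨C, hC⟩ := (isCompact_Icc (a := (0 : ℝ)) (b := R)).bddAbove_image hf.continuousOn
  replace hC : ∀ x ∈ Icc (0 : ℝ) R, f x ≤ C := fun x hx ↦ hC (mem_image_of_mem _ hx)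
  obtain ⟨z, hz, hcz⟩ := (isCompact_Icc (a := (0 : ℝ)) (b := R)).exists_isMinOn
    ⟨0, by simp [hR.le]⟩ hf.continuousOn
  obtain ⟨c, hc0, hc⟩ : ∃ c > 0, ∀ x ∈ Icc (0 : ℝ) R, c ≤ f x :=
    ⟨f z, hpos z, fun x hx ↦ hcz hx⟩
  have hC0 : 0 < C := (hpos 0).trans_le (hC 0 ⟨le_rfl, hR.le⟩)
  set ρ := blissDensity q r f with hρ
  set F : ℝ → ℝ := fun x ↦ ∫ t in 0..x, f t with hF
  set M : ℝ → ℝ := fun x ↦ ∫ t in 0..x, ρ t with hM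
  set P : ℝ → ℝ := fun x ↦ ∫ t in 0..x, f t ^ p with hP
  set I0 := ∫ y in Ioi 0, blissTail r (q / r) y with hI0
  set I1 := ∫ y in Ioi 0, blissHead r (q / r) y with hI1
  set J0 : ℝ → ℝ := fun Y ↦ ∫ y in 0..Y, blissTail r (q / r) y with hJ0
  set J1 : ℝ → ℝ := fun Y ↦ ∫ y in 0..Y, blissHead r (q / r) y with hJ1
  have hρc : ContinuousOn ρ (Ici 0) := continuousOn_blissDensity hf hpos hq0 hr
  have hF0 : ∀ x, 0 < x → 0 < F x := fun x hx ↦ integral_pos_of_pos hf hpos hx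
  have hFb : ∀ x ∈ Ioc 0 R, c ≤ F x / x ∧ F x / x ≤ C := fun x hx ↦ integral_bounds hf hc hC hx
  have hρ0 : ∀ x, 0 < x → 0 < ρ x := fun x hx ↦ by
    have := hF0 x hx
    simp only [hρ, blissDensity]; positivity
  have hρi : ∀ a b, 0 ≤ a → 0 ≤ b → IntervalIntegrable ρ volume a b := fun a b ha hb ↦
    (hρc.mono fun _ h ↦ (le_min ha hb).trans h.1).intervalIntegrable
  have hfp : Continuous fun t ↦ f t ^ p := hf.rpow_const fun x ↦ Or.inl (hpos x).ne'
  have hF' : ∀ x, HasDerivAt F (f x) x := fun x ↦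
    intervalIntegral.integral_hasDerivAt_right (hf.intervalIntegrable 0 x)
        hf.aestronglyMeasurable.stronglyMeasurableAtFilter hf.continuousAt
  have hP' : ∀ x, HasDerivAt P (f x ^ p) x := fun x ↦
    intervalIntegral.integral_hasDerivAt_right (hfp.intervalIntegrable 0 x)
        hfp.aestronglyMeasurable.stronglyMeasurableAtFilter hfp.continuousAt
  have hM' : ∀ x, 0 < x → HasDerivAt M (ρ x) x := fun x hx ↦
    hasDerivAt_integral_of_continuousOn_Ici hρc hx
  have hJ0' : ∀ y, 0 < y → HasDerivAt J0 (blissTail r (q / r) y) y := fun x hx ↦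
    hasDerivAt_integral_of_continuousOn_Ici (continuousOn_blissTail _ hr) hx
  have hMpos : ∀ x, 0 < x → 0 < M x := fun x hx ↦
    intervalIntegral.intervalIntegral_pos_of_pos_on (hρi 0 x le_rfl hx.le)
      (fun y hy ↦ hρ0 y hy.1) hx
  have hPpos : ∀ x, 0 < x → 0 < P x := fun x hx ↦
    integral_pos_of_pos hfp (fun x ↦ Real.rpow_pos_of_pos (hpos x) p) hx
  have hMle : ∀ x ∈ Ioc 0 R, M x ≤ M R := fun x hx ↦
    intervalIntegral.integral_mono_interval le_rfl hx.1.le hx.2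
      (by filter_upwards [ae_restrict_mem measurableSet_Ioc] with y hy using (hρ0 y hy.1).le)
      (hρi 0 R le_rfl hR.le)
  have hI1pos : 0 < I1 := integral_Ioi_blissHead_pos hr hN0 hN
  have hI01 : I0 = q / p' * I1 := by
    have h6 : q - r - 1 = q / p' := by rw [hpp, hq]; field_simp; ring
    rw [hI0, integral_Ioi_blissTail hr hN0 hN, hrN, h6]
  have hκ0 : 0 < κ := by
    by_contra! h
    have := hMpos R hR
    nlinarith
  have hI0pos : 0 < I0 := by rw [hI01]; positivity
  obtain ⟨Ψ, hΨ⟩ := exists_inverse_integral_blissHead hr hN0 hN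
  -- The transport map: `κ J1(Y(x)) = M(x)`.
  set Y : ℝ → ℝ := fun x ↦ Ψ (M x / κ) with hYdef
  have hmem : ∀ x ∈ Ioc 0 R, M x / κ ∈ Ioo 0 I1 := fun x hx ↦ by
    refine ⟨div_pos (hMpos x hx.1) hκ0, ?_⟩
    rw [div_lt_iff₀ hκ0, mul_comm]
    exact (hMle x hx).trans_lt hκ
  have hY0 : ∀ x ∈ Ioc 0 R, 0 < Y x := fun x hx ↦ (hΨ _ (hmem x hx)).1
  have hJY : ∀ x ∈ Ioc 0 R, κ * J1 (Y x) = M x := fun x hx ↦ by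
    have := (hΨ _ (hmem x hx)).2.1
    simp only [hJ1, hYdef]
    rw [this]; field_simp
  have hY' : ∀ x ∈ Ioc 0 R, HasDerivAt Y (ρ x / κ * (blissHead r (q / r) (Y x))⁻¹) x := by
    intro x hx
    have := (hΨ _ (hmem x hx)).2.2.comp x ((hM' x hx.1).div_const κ)
    rwa [mul_comm] at this
  -- `A` is the total of `f^p`, and `B` bounds the total of `ρ Y^(-r)`, so that the bracket
  -- multiplied by `b` in `Φ` never exceeds `1/p + 1/p' = 1`.
  set A := P R with hA
  set B := κ * I0 with hB
  have hA0 : 0 < A := hPpos R hR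
  have hB0 : 0 < B := mul_pos hκ0 hI0pos
  set a := q / p' * κ ^ (-(r / q)) with ha
  have ha0 : 0 < a := by positivity
  set b := (q - r) * (A ^ (1 / p) * B ^ (1 / p')) with hb
  have hb0 : 0 < b := by positivity
  set E : ℝ → ℝ := fun x ↦
    Real.exp ((q - r) * Real.log (F x) - (q - r) / p' * Real.log x - r / p' * Real.log (Y x))
    with hE
  -- An antiderivative of the difference of the two sides of `exp_log_calibration_le`.
  set Φ : ℝ → ℝ := fun x ↦ E x + a * (M x + κ * J0 (Y x)) -
    b * (P x / (p * A) + κ * J0 (Y x) / (p' * B)) with hΦ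
  have hΦ' : ∀ x ∈ Ioc 0 R, ∃ d ≤ 0, HasDerivAt Φ d x := by
    intro x hx
    have hYx := hY0 x hx
    have hE' := ((((hF' x).log (hF0 x hx.1).ne').const_mul (q - r)).sub
      ((Real.hasDerivAt_log hx.1.ne').const_mul ((q - r) / p'))).sub
      (((hY' x hx).log hYx.ne').const_mul (r / p')) |>.exp
    have hJ' := ((hJ0' _ hYx).comp x (hY' x hx)).const_mul κ
    -- Since head and tail kernels differ by the factor `y^r`, `κ J0(Y)` is a primitive of `ρ
    -- Y^(-r)`.
    have hJeq : κ * (blissTail r (q / r) (Y x) * (ρ x / κ * (blissHead r (q / r) (Y x))⁻¹)) =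
        ρ x * Y x ^ (-r) := by
      have h1 := blissTail_pos (r := r) (N := q / r) hYx.le
      have h2 : blissHead r (q / r) (Y x) = Y x ^ r * blissTail r (q / r) (Y x) := rfl
      rw [h2, Real.rpow_neg hYx.le]
      field_simp
    rw [hJeq] at hJ'
    refine ⟨_, ?_, (hE'.add (((hM' x hx.1).add hJ').const_mul a)).sub
      ((((hP' x).div_const (p * A)).add (hJ'.div_const (p' * B))).const_mul b)⟩
    have key := exp_log_calibration_le hp hr hq hκ0 hA0 hB0 (hpos x).le (hF0 x hx.1) hx.1 hYx
    have h3 : (F x / x) ^ q * x ^ r = ρ x := rfl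
    have h4 : Y x ^ r * (1 + Y x ^ r) ^ (-(q / r)) = blissHead r (q / r) (Y x) := rfl
    rw [h3, h4] at key
    rw [sub_nonpos]
    exact key
  have hanti : AntitoneOn Φ (Ioc 0 R) := by
    choose! d hd hd' using hΦ'
    refine antitoneOn_of_deriv_nonpos (convex_Ioc 0 R)
      (fun x hx ↦ (hd' x hx).continuousAt.continuousWithinAt) ?_ ?_
    · intro x hx
      exact (hd' x (interior_subset hx)).differentiableAt.differentiableWithinAt
    · intro x hx
      rw [(hd' x (interior_subset hx)).deriv]
      exact hd x (interior_subset hx)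
  have hJ0nn : ∀ y, 0 ≤ y → 0 ≤ J0 y := fun y hy ↦
    intervalIntegral.integral_nonneg hy fun t ht ↦ (blissTail_pos ht.1).le
  have hJ0le : ∀ y, 0 ≤ y → J0 y ≤ y := fun y hy ↦ by
    have := intervalIntegral.integral_mono_on hy (intervalIntegrable_blissTail (q / r) hr le_rfl hy)
      (intervalIntegrable_const (μ := volume) (c := (1 : ℝ))) (fun t ht ↦ by
        have h := Real.rpow_nonneg ht.1 r
        exact Real.rpow_le_one_of_one_le_of_nonpos (by linarith) (by linarith))
    simpa using this
  -- behaviour near the origin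
  have hMlim : Tendsto M (𝓝[>] 0) (𝓝 0) := by
    have h1 := intervalIntegral.continuousOn_primitive_interval (a := 0) (b := 1) (μ := volume)
      (f := ρ) (by
        rw [uIcc_of_le zero_le_one]
        exact (hρc.mono Icc_subset_Ici_self).integrableOn_Icc)
    have h2 := h1 0 (by simp)
    rw [ContinuousWithinAt, intervalIntegral.integral_same, uIcc_of_le zero_le_one] at h2
    refine h2.mono_left ?_
    rw [← nhdsWithin_Ioc_eq_nhdsGT (zero_lt_one (α := ℝ))]
    exact nhdsWithin_mono _ Ioc_subset_Icc_self
  have hnear : ∀ᶠ x in 𝓝[>] (0 : ℝ), x ∈ Ioc 0 R := Ioc_mem_nhdsGT hR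
  have hYlim : Tendsto Y (𝓝[>] 0) (𝓝 0) := by
    rw [Metric.tendsto_nhds]
    intro ε hε
    have hJε : 0 < κ * J1 ε := mul_pos hκ0 <|
      intervalIntegral.intervalIntegral_pos_of_pos_on (intervalIntegrable_blissHead _ hr le_rfl hε.le)
        (fun y hy ↦ blissHead_pos hy.1) hε
    filter_upwards [hMlim.eventually (gt_mem_nhds hJε), hnear] with x hx hxR
    rw [Real.dist_eq, sub_zero, abs_of_pos (hY0 x hxR)]
    by_contra! h
    rw [← hJY x hxR] at hx
    have : J1 ε ≤ J1 (Y x) := intervalIntegral.integral_mono_interval le_rfl hε.le h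
      (by filter_upwards [ae_restrict_mem measurableSet_Ioc] with y hy using (blissHead_pos hy.1).le)
      (intervalIntegrable_blissHead _ hr le_rfl (hY0 x hxR).le)
    nlinarith
  -- Comparing masses near the origin: `ρ ≥ c^q x^r`, while the target kernel is at most `y^r`.
  -- Hence `Y` is at least a multiple of `x`, which controls the negative power of `Y` in `E`.
  have hYlow : ∀ x ∈ Ioc 0 R, c ^ q * x ^ (r + 1) ≤ κ * Y x ^ (r + 1) := by
    intro x hx
    have h1 : c ^ q * (x ^ (r + 1) / (r + 1)) ≤ M x := by
      have := intervalIntegral.integral_mono_on hx.1.le (f := fun t ↦ c ^ q * t ^ r)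
        (((Real.continuous_rpow_const hr.le).const_smul (c ^ q)).intervalIntegrable 0 x)
        (hρi 0 x le_rfl hx.1.le) (fun t ht ↦ by
          rcases ht.1.eq_or_lt with rfl | ht0
          · simp [hρ, blissDensity, hr.ne']
          · refine mul_le_mul_of_nonneg_right ?_ (by positivity)
            exact Real.rpow_le_rpow hc0.le (hFb t ⟨ht0, ht.2.trans hx.2⟩).1 hq0.le)
      rwa [intervalIntegral.integral_const_mul, integral_rpow (Or.inl (by linarith)),
        Real.zero_rpow (by linarith), sub_zero] at this
    have h2 : J1 (Y x) ≤ Y x ^ (r + 1) / (r + 1) := by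
      have hYx := (hY0 x hx).le
      have := intervalIntegral.integral_mono_on hYx
        (intervalIntegrable_blissHead (q / r) hr le_rfl hYx)
        ((Real.continuous_rpow_const hr.le).intervalIntegrable 0 (Y x))
        (fun t ht ↦ blissHead_le_rpow hN0 ht.1)
      rwa [integral_rpow (Or.inl (by linarith)),
        Real.zero_rpow (by linarith), sub_zero] at this
    rw [← hJY x hx] at h1
    have h3 := h1.trans (mul_le_mul_of_nonneg_left h2 hκ0.le)
    rw [← mul_div_assoc, ← mul_div_assoc, div_le_div_iff_of_pos_right (by linarith)] at h3
    exact h3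
  have hElim : ∃ K, ∀ x ∈ Ioc 0 R, E x ≤ K * x := by
    set K := (c ^ q / κ) ^ (1 / (r + 1)) with hK
    have hK0 : 0 < K := by positivity
    refine ⟨Real.exp ((q - r) * Real.log C - r / p' * Real.log K), fun x hx ↦ ?_⟩
    have h1 : K * x ≤ Y x := by
      have h2 : c ^ q / κ * x ^ (r + 1) ≤ Y x ^ (r + 1) := by
        rw [div_mul_eq_mul_div, div_le_iff₀ hκ0, mul_comm _ κ]; exact hYlow x hx
      have h3 := Real.rpow_le_rpow (by have := hx.1; positivity) h2
        (show 0 ≤ 1 / (r + 1) by positivity)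
      rwa [Real.mul_rpow (by positivity) (by have := hx.1; positivity), ← Real.rpow_mul hx.1.le,
        ← Real.rpow_mul (hY0 x hx).le, mul_one_div_cancel (by linarith), Real.rpow_one,
        Real.rpow_one] at h3
    have h2 : Real.log K + Real.log x ≤ Real.log (Y x) := by
      rw [← Real.log_mul hK0.ne' hx.1.ne']
      exact Real.log_le_log (mul_pos hK0 hx.1) h1
    have h3 : Real.log (F x) ≤ Real.log C + Real.log x := by
      rw [← Real.log_mul hC0.ne' hx.1.ne']
      exact Real.log_le_log (hF0 x hx.1) ((div_le_iff₀ hx.1).1 (hFb x hx).2)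
    calc E x ≤ Real.exp ((q - r) * Real.log C - r / p' * Real.log K + Real.log x) := by
          refine Real.exp_le_exp.2 ?_
          have h4 := mul_le_mul_of_nonneg_left h3 hqr.le
          have h5 := mul_le_mul_of_nonneg_left h2 (show 0 ≤ r / p' by positivity)
          -- With `F ≤ Cx` and `Y` at least a multiple of `x`, this total exponent makes `E` of
          -- order at most `x`.
          have h6 : (q - r) - (q - r) / p' - r / p' = 1 := by
            rw [hpp, hq]; field_simp; ring
          linear_combination h4 + h5 + Real.log x * h6
      _ = _ := by rw [Real.exp_add, Real.exp_log hx.1]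
  obtain ⟨K, hK⟩ := hElim
  have hΦR : Φ R ≤ 0 := by
    -- Only an upper bound for `Φ` near the origin is needed, so the subtracted nonnegative term is
    -- dropped.
    have hlim : Tendsto (fun x ↦ K * x + a * (M x + κ * Y x)) (𝓝[>] 0) (𝓝 0) := by
      have h1 : Tendsto (fun x : ℝ ↦ x) (𝓝[>] 0) (𝓝 0) := tendsto_id.mono_left nhdsWithin_le_nhds
      simpa using (h1.const_mul K).add ((hMlim.add (hYlim.const_mul κ)).const_mul a)
    refine ge_of_tendsto hlim ?_
    filter_upwards [hnear] with x hx
    refine (hanti hx ⟨hR, le_rfl⟩ hx.2).trans ?_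
    have h1 := hK x hx
    have h2 : a * (M x + κ * J0 (Y x)) ≤ a * (M x + κ * Y x) := by
      gcongr; exact hJ0le _ (hY0 x hx).le
    have h3 : 0 ≤ b * (P x / (p * A) + κ * J0 (Y x) / (p' * B)) := by
      have := (hPpos x hx.1).le
      have := hJ0nn _ (hY0 x hx).le
      positivity
    simp only [hΦ]
    linarith
  have hYR := hY0 R ⟨hR, le_rfl⟩
  have h1 : κ * J0 (Y R) ≤ B := mul_le_mul_of_nonneg_left
    (intervalIntegral_le_integral_Ioi (integrableOn_blissTail hr hN0 hN)
      (fun y hy ↦ (blissTail_pos hy.le).le) hYR.le) hκ0.le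
  have h2 : b * (P R / (p * A) + κ * J0 (Y R) / (p' * B)) ≤ b := by
    refine mul_le_of_le_one_right hb0.le ?_
    calc _ ≤ A / (p * A) + B / (p' * B) := by gcongr
      _ = p⁻¹ + p'⁻¹ := by field_simp
      _ = 1 := hp.inv_add_inv_eq_one
  -- The boundary term at the finite point `Y R` has a favourable sign. Together with `q - r = 1 +
  -- q/p'` this yields the factor `q - r`, which cancels the one in `b`.
  have h3 : q / p' * M R ≤ κ * J0 (Y R) := by
    have h4 := integral_blissTail_sub (r := r) (N := q / r) hr hYR.le
    have h5 : 0 ≤ Y R * (1 + Y R ^ r) ^ (1 - q / r) := by positivity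
    rw [← h4, sub_nonneg, hrN] at h5
    have h6 : q - r - 1 = q / p' := by rw [hpp, hq]; field_simp; ring
    rw [h6] at h5
    rw [← hJY R ⟨hR, le_rfl⟩]
    calc _ = κ * (q / p' * J1 (Y R)) := by ring
      _ ≤ _ := mul_le_mul_of_nonneg_left h5 hκ0.le
  have h4 : 0 < E R := Real.exp_pos _
  have h5 : a * (M R + q / p' * M R) ≤ a * (M R + κ * J0 (Y R)) := by gcongr
  have h6 : a * ((q - r) * M R) ≤ b := by
    have h7 : q - r = 1 + q / p' := by rw [hpp, hq]; field_simp; ring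
    rw [h7]
    simp only [hΦ] at hΦR
    linarith
  rw [hb, mul_left_comm] at h6
  exact le_of_mul_le_mul_left h6 hqr

/-- **Bliss's inequality** on a bounded interval, for positive continuous functions. -/
theorem integral_blissDensity_le {p p' q r R : ℝ} (hp : p.HolderConjugate p')
    (hr : 0 < r) (hq : q = p * (r + 1)) {f : ℝ → ℝ} (hf : Continuous f) (hpos : ∀ x, 0 < f x)
    (hR : 0 < R) :
    ∫ x in 0..R, blissDensity q r f x ≤
      p' / q * (∫ y in Ioi 0, blissTail r (q / r) y) ^ (-r) *
        (∫ x in 0..R, f x ^ p) ^ (q / p) := by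
  have hp0 := hp.pos
  have hp1 := hp.lt
  have hp'0 := hp.symm.pos
  have hpp : p' = p / (p - 1) := hp.conjugate_eq
  have hp10 : 0 < p - 1 := by linarith
  have hqr : 0 < q - r := by rw [hq]; nlinarith
  have hq0 : 0 < q := by linarith
  have hN0 : 0 ≤ q / r := by positivity
  have hrN : r * (q / r) = q := by field_simp
  have hN : 1 + r < r * (q / r) := by rw [hrN, hq]; nlinarith
  have hI1pos := integral_Ioi_blissHead_pos hr hN0 hN
  have hI01 : ∫ y in Ioi 0, blissTail r (q / r) y =
      q / p' * ∫ y in Ioi 0, blissHead r (q / r) y := by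
    have h6 : q - r - 1 = q / p' := by rw [hpp, hq]; field_simp; ring
    rw [integral_Ioi_blissTail hr hN0 hN, hrN, h6]
  have haux := fun κ ↦ integral_blissDensity_le_aux (κ := κ) hp hr hq hf hpos hR
  have hfp : Continuous fun t ↦ f t ^ p := hf.rpow_const fun x ↦ Or.inl (hpos x).ne'
  have hA : 0 < ∫ x in 0..R, f x ^ p :=
    integral_pos_of_pos hfp (fun x ↦ Real.rpow_pos_of_pos (hpos x) p) hR
  have hM : 0 < ∫ x in 0..R, blissDensity q r f x := by
    refine intervalIntegral.intervalIntegral_pos_of_pos_on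
      ((continuousOn_blissDensity hf hpos hq0 hr).mono
        fun _ h ↦ (le_min le_rfl hR.le).trans h.1).intervalIntegrable (fun x hx ↦ ?_) hR
    have := integral_pos_of_pos hf hpos hx.1
    have := hx.1
    unfold blissDensity; positivity
  rw [hI01] at haux ⊢
  generalize (∫ y in Ioi 0, blissHead r (q / r) y) = I at *
  generalize (∫ x in 0..R, blissDensity q r f x) = M at *
  generalize (∫ x in 0..R, f x ^ p) = A at *
  have hκ0 : 0 < M / I := by positivity
  -- Let `κ` decrease to `M / I`, where the target mass equals the mass of the density.
  have hlim : q / p' * (M / I) ^ (-(r / q)) * M ≤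
      A ^ (1 / p) * (M / I * (q / p' * I)) ^ (1 / p') := by
    have h1 : ContinuousAt (fun κ : ℝ ↦ q / p' * κ ^ (-(r / q)) * M) (M / I) :=
      ((Real.continuousAt_rpow_const _ _ (Or.inl hκ0.ne')).const_mul _).mul_const _
    have h2 : ContinuousAt (fun κ : ℝ ↦ A ^ (1 / p) * (κ * (q / p' * I)) ^ (1 / p')) (M / I) := by
      refine ContinuousAt.const_mul ?_ _
      exact ContinuousAt.rpow_const (by fun_prop) (Or.inl (by positivity))
    refine le_of_tendsto_of_tendsto (h1.mono_left (nhdsWithin_le_nhds (s := Ioi (M / I))))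
      (h2.mono_left nhdsWithin_le_nhds) ?_
    filter_upwards [self_mem_nhdsWithin] with κ hκ
    exact haux κ ((div_lt_iff₀ hI1pos).1 hκ)
  set s := q / p' with hs
  have hs0 : 0 < s := by positivity
  -- At this `κ` both sides contain `(sM)^(1/p')`; cancelling it leaves an inequality whose `q`-th
  -- power is the claim.
  have h1 : (s * M) ^ (1 / q) * (s * I) ^ (r / q) ≤ A ^ (1 / p) := by
    have h2 : M / I * (s * I) = s * M := by field_simp
    rw [h2] at hlim
    have h3 : s * (M / I) ^ (-(r / q)) * M = (s * M) ^ (1 / q) * (s * I) ^ (r / q) *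
        (s * M) ^ (1 / p') := by
      clear_value s
      obtain ⟨a, rfl⟩ : ∃ a, Real.exp a = M := ⟨_, Real.exp_log hM⟩
      obtain ⟨b, rfl⟩ : ∃ a, Real.exp a = I := ⟨_, Real.exp_log hI1pos⟩
      obtain ⟨c, rfl⟩ : ∃ a, Real.exp a = s := ⟨_, Real.exp_log hs0⟩
      simp only [← Real.exp_sub, ← Real.exp_add, ← Real.exp_mul]
      congr 1
      rw [hpp, hq]
      field_simp
      ring
    rw [h3] at hlim
    exact le_of_mul_le_mul_right hlim (by positivity)
  have h2 := Real.rpow_le_rpow (by positivity) h1 hq0.le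
  rw [Real.mul_rpow (by positivity) (by positivity), ← Real.rpow_mul (by positivity),
    ← Real.rpow_mul (by positivity), ← Real.rpow_mul (by positivity), one_div_mul_cancel hq0.ne',
    Real.rpow_one, div_mul_cancel₀ _ hq0.ne', one_div_mul_eq_div] at h2
  rw [Real.rpow_neg (by positivity)]
  have h3 : p' / q = s⁻¹ := by rw [hs, inv_div]
  rw [h3]
  have hsI : 0 < (s * I) ^ r := by positivity
  calc M = s⁻¹ * ((s * I) ^ r)⁻¹ * (s * M * (s * I) ^ r) := by field_simp
    _ ≤ _ := mul_le_mul_of_nonneg_left h2 (by positivity)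

/-- Bliss's inequality in terms of lower integrals, for positive continuous functions. -/
theorem lintegral_bliss_of_continuous {p p' q r R : ℝ} (hp : p.HolderConjugate p')
    (hr : 0 < r) (hq : q = p * (r + 1)) {f : ℝ → ℝ} (hf : Continuous f) (hpos : ∀ x, 0 < f x)
    (hR : 0 < R) :
    ∫⁻ x in Ioc 0 R, (∫⁻ t in Ioc 0 x, ‖f t‖ₑ) ^ q * ENNReal.ofReal (x ^ (r - q)) ≤
      ENNReal.ofReal (p' / q * (∫ y in Ioi 0, blissTail r (q / r) y) ^ (-r)) *
        (eLpNorm f (ENNReal.ofReal p) (volume.restrict (Ioc 0 R))) ^ q := by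
  have hp0 := hp.pos
  have hp1 := hp.lt
  have hp'0 := hp.symm.pos
  have hq0 : 0 < q := by rw [hq]; positivity
  have hen : ∀ t, ‖f t‖ₑ = ENNReal.ofReal (f t) := fun t ↦ Real.enorm_of_nonneg (hpos t).le
  have hI0 : 0 ≤ ∫ y in Ioi 0, blissTail r (q / r) y :=
    setIntegral_nonneg measurableSet_Ioi fun y hy ↦ (blissTail_pos (le_of_lt hy)).le
  have hA : 0 ≤ ∫ x in 0..R, f x ^ p :=
    intervalIntegral.integral_nonneg hR.le fun x _ ↦ Real.rpow_nonneg (hpos x).le p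
  have hfp : Continuous fun t ↦ f t ^ p := hf.rpow_const fun x ↦ Or.inl (hpos x).ne'
  have hleft : ∫⁻ x in Ioc 0 R, (∫⁻ t in Ioc 0 x, ‖f t‖ₑ) ^ q * ENNReal.ofReal (x ^ (r - q)) =
      ENNReal.ofReal (∫ x in 0..R, blissDensity q r f x) := by
    rw [intervalIntegral.integral_of_le hR.le, ofReal_integral_eq_lintegral_ofReal]
    · refine setLIntegral_congr_fun measurableSet_Ioc fun x hx ↦ ?_
      have h1 : ∫⁻ t in Ioc 0 x, ‖f t‖ₑ = ENNReal.ofReal (∫ t in 0..x, f t) := by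
        rw [intervalIntegral.integral_of_le hx.1.le, ofReal_integral_eq_lintegral_ofReal]
        · simp_rw [hen]
        · exact (hf.integrableOn_Icc).mono_set Ioc_subset_Icc_self
        · exact Eventually.of_forall fun x ↦ (hpos x).le
      have h2 := integral_pos_of_pos hf hpos hx.1
      simp only [h1]
      rw [ENNReal.ofReal_rpow_of_pos h2, ← ENNReal.ofReal_mul (by positivity)]
      congr 1
      rw [blissDensity, Real.div_rpow h2.le hx.1.le, Real.rpow_sub hx.1]
      ring
    · exact (((continuousOn_blissDensity hf hpos hq0 hr).mono Icc_subset_Ici_self).integrableOn_Icc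
        ).mono_set Ioc_subset_Icc_self
    · filter_upwards [ae_restrict_mem measurableSet_Ioc] with x hx
      have := integral_pos_of_pos hf hpos hx.1
      have := hx.1
      simp only [blissDensity, Pi.zero_apply]; positivity
  have hright : (eLpNorm f (ENNReal.ofReal p) (volume.restrict (Ioc 0 R))) ^ q =
      ENNReal.ofReal ((∫ x in 0..R, f x ^ p) ^ (q / p)) := by
    rw [eLpNorm_eq_lintegral_rpow_enorm_toReal (by simpa using hp0) (by simp),
      ENNReal.toReal_ofReal hp0.le, ← ENNReal.rpow_mul, one_div_mul_eq_div,
      ← ENNReal.ofReal_rpow_of_nonneg hA (by positivity), intervalIntegral.integral_of_le hR.le,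
      ofReal_integral_eq_lintegral_ofReal]
    · congr 2 with x
      rw [hen, ENNReal.ofReal_rpow_of_pos (hpos x)]
    · exact hfp.integrableOn_Icc.mono_set Ioc_subset_Icc_self
    · exact Eventually.of_forall fun x ↦ Real.rpow_nonneg (hpos x).le p
  rw [hleft, hright, ← ENNReal.ofReal_mul (by positivity)]
  exact ENNReal.ofReal_le_ofReal (integral_blissDensity_le hp hr hq hf hpos hR)

/-! ### Extension to measurable functions on the half-line -/

/-- Taking `|g k|` does not increase the distance to the nonnegative `α`. Adding `1/(k+1)` makes the
approximant strictly positive, and its norm is small because the interval has finite measure. -/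
theorem exists_continuous_pos_tendsto_eLpNorm {p R : ℝ} (hp1 : 1 ≤ p) {α : ℝ → ℝ}
    (hα0 : ∀ x, 0 ≤ α x) (hα : MemLp α (ENNReal.ofReal p) volume) :
    ∃ f : ℕ → ℝ → ℝ, (∀ k, Continuous (f k)) ∧ (∀ k x, 0 < f k x) ∧
      Tendsto (fun k ↦ eLpNorm (α - f k) (ENNReal.ofReal p) (volume.restrict (Ioc 0 R)))
        atTop (𝓝 0) := by
  have hp1' : 1 ≤ ENNReal.ofReal p := by simpa using hp1
  have := fun k : ℕ ↦ hα.exists_hasCompactSupport_eLpNorm_sub_le (by simp)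
    (ε := ((k : NNReal) + 1)⁻¹) (by simp)
  choose g _ hg hgc hgm using this
  refine ⟨fun k x ↦ |g k x| + ((k : ℝ) + 1)⁻¹, fun k ↦ (hgc k).abs.add continuous_const,
    fun k x ↦ by positivity, ?_⟩
  set μ := volume.restrict (Ioc 0 R)
  have hμ : μ univ ≠ ∞ := by simp [μ]
  have hbound : ∀ k, eLpNorm (α - fun x ↦ |g k x| + ((k : ℝ) + 1)⁻¹) (ENNReal.ofReal p) μ ≤
      ENNReal.ofReal (((k : ℝ) + 1)⁻¹) +
        ENNReal.ofReal (((k : ℝ) + 1)⁻¹) * μ univ ^ (1 / (ENNReal.ofReal p).toReal) := by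
    intro k
    have h1 : (α - fun x ↦ |g k x| + ((k : ℝ) + 1)⁻¹) =
        (fun x ↦ α x - |g k x|) + fun _ ↦ -((k : ℝ) + 1)⁻¹ := by ext x; simp; ring
    rw [h1]
    refine (eLpNorm_add_le ?_ aestronglyMeasurable_const hp1').trans (add_le_add ?_ ?_)
    · exact hα.1.restrict.sub (hgc k).abs.aestronglyMeasurable
    · calc _ ≤ eLpNorm (α - g k) (ENNReal.ofReal p) μ := by
            refine eLpNorm_mono fun x ↦ ?_
            have := abs_abs_sub_abs_le (α x) (g k x)
            rw [abs_of_nonneg (hα0 x)] at this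
            simpa using this
        _ ≤ eLpNorm (α - g k) (ENNReal.ofReal p) volume := eLpNorm_restrict_le ..
        _ ≤ _ := by
            refine (hg k).trans (le_of_eq ?_)
            rw [ENNReal.ofReal, Real.toNNReal_inv, Real.toNNReal_add (by positivity) zero_le_one]
            simp
    · rw [eLpNorm_const' _ (by simp; linarith) (by simp)]
      have h2 : (0 : ℝ) < (k : ℝ) + 1 := by positivity
      rw [enorm_neg, Real.enorm_of_nonneg (by positivity)]
  refine tendsto_of_tendsto_of_tendsto_of_le_of_le tendsto_const_nhds ?_ (fun k ↦ zero_le) hbound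
  have h0 : Tendsto (fun k : ℕ ↦ ENNReal.ofReal (((k : ℝ) + 1)⁻¹)) atTop (𝓝 0) := by
    have := ENNReal.tendsto_ofReal (tendsto_one_div_add_atTop_nhds_zero_nat (𝕜 := ℝ))
    simpa using this
  have h1 := h0.add (ENNReal.Tendsto.mul_const (b := μ univ ^ (1 / (ENNReal.ofReal p).toReal)) h0
    (Or.inr (ENNReal.rpow_ne_top_of_nonneg (by positivity) hμ)))
  simpa using h1

/-- **Bliss's inequality** on a bounded interval. -/
theorem lintegral_bliss_of_memLp {p p' q r R : ℝ} (hp : p.HolderConjugate p')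
    (hr : 0 < r) (hq : q = p * (r + 1)) {α : ℝ → ℝ} (hα0 : ∀ x, 0 ≤ α x)
    (hα : MemLp α (ENNReal.ofReal p) volume) (hR : 0 < R) :
    ∫⁻ x in Ioc 0 R, (∫⁻ t in Ioc 0 x, ‖α t‖ₑ) ^ q * ENNReal.ofReal (x ^ (r - q)) ≤
      ENNReal.ofReal (p' / q * (∫ y in Ioi 0, blissTail r (q / r) y) ^ (-r)) *
        (eLpNorm α (ENNReal.ofReal p) (volume.restrict (Ioc 0 R))) ^ q := by
  have hp1 := hp.lt
  have hq0 : 0 < q := by rw [hq]; have := hp.pos; positivity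
  have hp1' : 1 ≤ ENNReal.ofReal p := by simpa using hp1.le
  obtain ⟨f, hfc, hfpos, hlim⟩ := exists_continuous_pos_tendsto_eLpNorm (R := R) hp1.le hα0 hα
  set K := ENNReal.ofReal (p' / q * (∫ y in Ioi 0, blissTail r (q / r) y) ^ (-r))
  set μ := volume.restrict (Ioc 0 R) with hμ
  set δ : ℕ → ℝ≥0∞ := fun k ↦ eLpNorm (α - f k) (ENNReal.ofReal p) μ with hδ
  set c : ℝ≥0∞ := μ univ ^ (1 / (1 : ℝ≥0∞).toReal - 1 / (ENNReal.ofReal p).toReal) with hc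
  have hc_top : c ≠ ∞ := by
    refine ENNReal.rpow_ne_top_of_nonneg ?_ (by simp [hμ])
    rw [ENNReal.toReal_ofReal (by linarith), ENNReal.toReal_one, sub_nonneg,
      div_le_div_iff₀ (by linarith) one_pos]
    linarith
  have hmeas : ∀ k, AEStronglyMeasurable (α - f k) μ := fun k ↦
    hα.1.restrict.sub (hfc k).aestronglyMeasurable
  have hη : Tendsto (fun k ↦ δ k * c) atTop (𝓝 0) := by
    simpa using ENNReal.Tendsto.mul_const hlim (Or.inr hc_top)
  have hF : ∀ x ∈ Ioc 0 R, ∀ k,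
      -- On a bounded interval the `L^p` error controls the `L^1` error, uniformly in `x`; this
      -- gives pointwise lower bounds on the primitives, to which Fatou's lemma applies.
      (∫⁻ t in Ioc 0 x, ‖α t‖ₑ) - δ k * c ≤ ∫⁻ t in Ioc 0 x, ‖f k t‖ₑ := by
    intro x hx k
    rw [tsub_le_iff_right]
    calc ∫⁻ t in Ioc 0 x, ‖α t‖ₑ ≤ ∫⁻ t in Ioc 0 x, (‖f k t‖ₑ + ‖(α - f k) t‖ₑ) := by
          refine lintegral_mono fun t ↦ ?_
          calc ‖α t‖ₑ = ‖f k t + (α - f k) t‖ₑ := by simp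
            _ ≤ _ := enorm_add_le _ _
      _ = (∫⁻ t in Ioc 0 x, ‖f k t‖ₑ) + ∫⁻ t in Ioc 0 x, ‖(α - f k) t‖ₑ :=
          lintegral_add_left (hfc k).measurable.enorm _
      _ ≤ (∫⁻ t in Ioc 0 x, ‖f k t‖ₑ) + ∫⁻ t, ‖(α - f k) t‖ₑ ∂μ := by
          gcongr
          exact Measure.restrict_mono (Ioc_subset_Ioc_right hx.2) le_rfl
      _ ≤ _ := by
          gcongr
          rw [← eLpNorm_one_eq_lintegral_enorm]
          exact eLpNorm_le_eLpNorm_mul_rpow_measure_univ hp1' (hmeas k)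
  have hpoint : ∀ x ∈ Ioc 0 R,
      (∫⁻ t in Ioc 0 x, ‖α t‖ₑ) ^ q * ENNReal.ofReal (x ^ (r - q)) ≤
        liminf (fun k ↦ (∫⁻ t in Ioc 0 x, ‖f k t‖ₑ) ^ q * ENNReal.ofReal (x ^ (r - q))) atTop := by
    intro x hx
    have h1 : Tendsto (fun k ↦ (∫⁻ t in Ioc 0 x, ‖α t‖ₑ) - δ k * c) atTop
        (𝓝 (∫⁻ t in Ioc 0 x, ‖α t‖ₑ)) := by
      simpa using ENNReal.Tendsto.sub tendsto_const_nhds hη (Or.inr ENNReal.zero_ne_top)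
    have h2 := ENNReal.Tendsto.mul_const (b := ENNReal.ofReal (x ^ (r - q)))
      ((ENNReal.continuous_rpow_const (y := q)).continuousAt.tendsto.comp h1)
      (Or.inr ENNReal.ofReal_ne_top)
    rw [← h2.liminf_eq]
    refine liminf_le_liminf (Eventually.of_forall fun k ↦ ?_)
    simp only [Function.comp]
    gcongr
    exact hF x hx k
  have hmono : ∀ k, Monotone fun x ↦ ∫⁻ t in Ioc 0 x, ‖f k t‖ₑ := fun k x y hxy ↦
    lintegral_mono_set (Ioc_subset_Ioc_right hxy)
  calc ∫⁻ x in Ioc 0 R, (∫⁻ t in Ioc 0 x, ‖α t‖ₑ) ^ q * ENNReal.ofReal (x ^ (r - q))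
      ≤ ∫⁻ x in Ioc 0 R, liminf (fun k ↦ (∫⁻ t in Ioc 0 x, ‖f k t‖ₑ) ^ q *
          ENNReal.ofReal (x ^ (r - q))) atTop := setLIntegral_mono' measurableSet_Ioc hpoint
    _ ≤ liminf (fun k ↦ ∫⁻ x in Ioc 0 R, (∫⁻ t in Ioc 0 x, ‖f k t‖ₑ) ^ q *
          ENNReal.ofReal (x ^ (r - q))) atTop := by
        refine lintegral_liminf_le fun k ↦ ?_
        have := (hmono k).measurable
        fun_prop
    _ ≤ liminf (fun k ↦ K * (eLpNorm α (ENNReal.ofReal p) μ + δ k) ^ q) atTop := by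
        refine liminf_le_liminf (Eventually.of_forall fun k ↦ ?_)
        refine (lintegral_bliss_of_continuous hp hr hq (hfc k) (hfpos k) hR).trans ?_
        gcongr
        calc eLpNorm (f k) (ENNReal.ofReal p) μ
            = eLpNorm (α - (α - f k)) (ENNReal.ofReal p) μ := by simp
          _ ≤ _ := eLpNorm_sub_le hα.1.restrict (hmeas k) hp1'
    _ = K * eLpNorm α (ENNReal.ofReal p) μ ^ q := by
        refine Tendsto.liminf_eq ?_
        refine ENNReal.Tendsto.const_mul ?_ (Or.inr ENNReal.ofReal_ne_top)
        refine (ENNReal.continuous_rpow_const (y := q)).continuousAt.tendsto.comp ?_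
        simpa using tendsto_const_nhds.add hlim

/-- **Bliss's inequality** on `(0, ∞)`. -/
theorem lintegral_bliss {p p' q r : ℝ} (hp : p.HolderConjugate p')
    (hr : 0 < r) (hq : q = p * (r + 1)) {a : ℝ → ℝ≥0∞}
    (ha : AEMeasurable a (volume.restrict (Ioi 0))) :
    ∫⁻ x in Ioi 0, (∫⁻ t in Ioc 0 x, a t) ^ q * ENNReal.ofReal (x ^ (r - q)) ≤
      ENNReal.ofReal (p' / q * (∫ y in Ioi 0, blissTail r (q / r) y) ^ (-r)) *
        (∫⁻ t in Ioi 0, a t ^ p) ^ (q / p) := by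
  have hp0 := hp.pos
  have hp1 := hp.lt
  have hp'0 := hp.symm.pos
  have hq0 : 0 < q := by rw [hq]; positivity
  have hN0 : 0 ≤ q / r := by positivity
  have hrN : r * (q / r) = q := by field_simp
  have hN : 1 + r < r * (q / r) := by rw [hrN, hq]; nlinarith
  have hI0 : 0 < ∫ y in Ioi 0, blissTail r (q / r) y := by
    rw [integral_Ioi_blissTail hr hN0 hN]
    exact mul_pos (by linarith) (integral_Ioi_blissHead_pos hr hN0 hN)
  have hK : ENNReal.ofReal (p' / q * (∫ y in Ioi 0, blissTail r (q / r) y) ^ (-r)) ≠ 0 := by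
    rw [Ne, ENNReal.ofReal_eq_zero, not_le]; positivity
  by_cases htop : ∫⁻ t in Ioi 0, a t ^ p = ∞
  · rw [htop, ENNReal.top_rpow_of_pos (by positivity), ENNReal.mul_top hK]
    -- When the right side is finite, `a` is finite almost everywhere and can be replaced by a real
    -- `L^p` function.
    exact le_top
  have hfin : ∀ᵐ t ∂(volume.restrict (Ioi 0)), a t < ∞ := by
    filter_upwards [ae_lt_top' (ha.pow_const p) htop] with t ht
    by_contra! h
    rw [top_le_iff.1 h, ENNReal.top_rpow_of_pos hp0] at ht
    exact lt_irrefl _ ht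
  set α : ℝ → ℝ := (Ioi 0).indicator fun t ↦ (a t).toReal with hα
  have hαe : ∀ᵐ t ∂(volume.restrict (Ioi 0)), ‖α t‖ₑ = a t := by
    filter_upwards [hfin, ae_restrict_mem measurableSet_Ioi] with t ht ht0
    rw [hα, indicator_of_mem ht0, Real.enorm_of_nonneg ENNReal.toReal_nonneg,
      ENNReal.ofReal_toReal ht.ne]
  have hα0 : ∀ t, 0 ≤ α t := fun t ↦ indicator_nonneg (fun _ _ ↦ ENNReal.toReal_nonneg) t
  have hnorm : eLpNorm α (ENNReal.ofReal p) (volume.restrict (Ioi 0)) =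
      (∫⁻ t in Ioi 0, a t ^ p) ^ (1 / p) := by
    rw [eLpNorm_eq_lintegral_rpow_enorm_toReal (by simpa using hp0) (by simp),
      ENNReal.toReal_ofReal hp0.le]
    congr 1
    refine lintegral_congr_ae ?_
    filter_upwards [hαe] with t ht
    rw [ht]
  have hmem : MemLp α (ENNReal.ofReal p) volume := by
    rw [memLp_indicator_iff_restrict measurableSet_Ioi]
    refine ⟨ha.ennreal_toReal.aestronglyMeasurable, ?_⟩
    rw [← eLpNorm_indicator_eq_eLpNorm_restrict measurableSet_Ioi, ← hα,
      ← eLpNorm_restrict_eq_of_support_subset (s := Ioi 0) support_indicator_subset, hnorm]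
    exact ENNReal.rpow_lt_top_of_nonneg (by positivity) htop
  have hunion : (Ioi 0 : Set ℝ) = ⋃ n : ℕ, Ioc 0 ((n : ℝ) + 1) := by
    ext x
    simp only [mem_Ioi, mem_iUnion, mem_Ioc]
    refine ⟨fun hx ↦ ?_, fun ⟨_, h⟩ ↦ h.1⟩
    obtain ⟨n, hn⟩ := exists_nat_ge x
    exact ⟨n, hx, by linarith⟩
  conv_lhs => rw [hunion]
  -- The constant on `(0, R]` does not depend on `R`, so monotone exhaustion gives the half-line.
  rw [setLIntegral_iUnion_of_directed]
  · refine iSup_le fun n ↦ ?_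
    have h1 := lintegral_bliss_of_memLp hp hr hq hα0 hmem (R := (n : ℝ) + 1) (by positivity)
    have h2 : eLpNorm α (ENNReal.ofReal p) (volume.restrict (Ioc 0 ((n : ℝ) + 1))) ≤
        (∫⁻ t in Ioi 0, a t ^ p) ^ (1 / p) :=
      (eLpNorm_mono_measure _ (Measure.restrict_mono Ioc_subset_Ioi_self le_rfl)).trans hnorm.le
    have h3 : (∫⁻ t in Ioi 0, a t ^ p) ^ (q / p) = ((∫⁻ t in Ioi 0, a t ^ p) ^ (1 / p)) ^ q := by
      rw [← ENNReal.rpow_mul, one_div_mul_eq_div]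
    rw [h3]
    refine (le_of_eq ?_).trans (h1.trans (by gcongr))
    refine lintegral_congr fun x ↦ ?_
    congr 2
    exact (lintegral_congr_ae (ae_restrict_of_ae_restrict_of_subset Ioc_subset_Ioi_self hαe)).symm
  · refine Monotone.directed_le fun m n hmn ↦ Ioc_subset_Ioc_right ?_
    have : (m : ℝ) ≤ n := by exact_mod_cast hmn
    linarith

/-! ### The extremal function and the beta integral -/

/-- For `N = (r+1)/r` the coefficient `rN - r - 1` is zero, so `integral_blissTail_sub` gives the
primitive of the extremal in closed form. -/
theorem lintegral_Ioc_blissTail {r x : ℝ} (hr : 0 < r) (hx : 0 < x) :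
    ∫⁻ t in Ioc 0 x, ENNReal.ofReal (blissTail r ((r + 1) / r) t) =
      ENNReal.ofReal (x * (1 + x ^ r) ^ (-(1 / r))) := by
  have h := integral_blissTail_sub (r := r) (N := (r + 1) / r) hr hx.le
  have h1 : r * ((r + 1) / r) - r - 1 = 0 := by field_simp; ring
  have h2 : 1 - (r + 1) / r = -(1 / r) := by field_simp; ring
  rw [h1, h2, zero_mul, sub_zero] at h
  rw [← h, intervalIntegral.integral_of_le hx.le, ofReal_integral_eq_lintegral_ofReal]
  · exact (intervalIntegrable_blissTail _ hr le_rfl hx.le).1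
  · filter_upwards [ae_restrict_mem measurableSet_Ioc] with t ht using (blissTail_pos ht.1.le).le

theorem lintegral_Ioi_blissTail_rpow {p q r : ℝ} (hp : 1 < p) (hr : 0 < r)
    (hq : q = p * (r + 1)) :
    ∫⁻ t in Ioi 0, ENNReal.ofReal (blissTail r ((r + 1) / r) t) ^ p =
      ENNReal.ofReal (∫ y in Ioi 0, blissTail r (q / r) y) := by
  have hq0 : 0 < q := by rw [hq]; positivity
  have hrN : r * (q / r) = q := by field_simp
  rw [ofReal_integral_eq_lintegral_ofReal
    (integrableOn_blissTail hr (by positivity) (by rw [hrN, hq]; nlinarith))]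
  · refine setLIntegral_congr_fun measurableSet_Ioi fun t ht ↦ ?_
    have ht : 0 < t := ht
    rw [ENNReal.ofReal_rpow_of_pos (blissTail_pos ht.le), blissTail, blissTail,
      ← Real.rpow_mul (by positivity), hq]
    congr 2
    ring
  · filter_upwards [ae_restrict_mem measurableSet_Ioi] with t ht using
      (blissTail_pos (le_of_lt ht)).le

/-- Equality holds in Bliss's inequality for `(1 + t^r)^{-(r+1)/r}`. -/
theorem lintegral_bliss_extremal {p p' q r : ℝ} (hp : p.HolderConjugate p')
    (hr : 0 < r) (hq : q = p * (r + 1)) :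
    ∫⁻ x in Ioi 0, (∫⁻ t in Ioc 0 x, ENNReal.ofReal (blissTail r ((r + 1) / r) t)) ^ q *
        ENNReal.ofReal (x ^ (r - q)) =
      ENNReal.ofReal (p' / q * (∫ y in Ioi 0, blissTail r (q / r) y) ^ (-r)) *
        (∫⁻ t in Ioi 0, ENNReal.ofReal (blissTail r ((r + 1) / r) t) ^ p) ^ (q / p) := by
  have hp0 := hp.pos
  have hp1 := hp.lt
  have hp'0 := hp.symm.pos
  have hpp : p' = p / (p - 1) := hp.conjugate_eq
  have hp10 : 0 < p - 1 := by linarith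
  have hq0 : 0 < q := by rw [hq]; positivity
  have hN0 : 0 ≤ q / r := by positivity
  have hrN : r * (q / r) = q := by field_simp
  have hN : 1 + r < r * (q / r) := by rw [hrN, hq]; nlinarith
  have hI1 := integral_Ioi_blissHead_pos hr hN0 hN
  have h6 : q - r - 1 = q / p' := by rw [hpp, hq]; field_simp; ring
  have hI01 := integral_Ioi_blissTail hr hN0 hN
  rw [hrN, h6] at hI01
  have hI0 : 0 < ∫ y in Ioi 0, blissTail r (q / r) y := by rw [hI01]; positivity
  -- The Bliss density of the extremal is exactly the head kernel, so its transport map with `κ = 1`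
  -- is the identity.
  have hleft : ∫⁻ x in Ioi 0, (∫⁻ t in Ioc 0 x, ENNReal.ofReal (blissTail r ((r + 1) / r) t)) ^ q *
        ENNReal.ofReal (x ^ (r - q)) = ENNReal.ofReal (∫ y in Ioi 0, blissHead r (q / r) y) := by
    rw [ofReal_integral_eq_lintegral_ofReal (integrableOn_blissHead hr hN0 hN)]
    · refine setLIntegral_congr_fun measurableSet_Ioi fun x hx ↦ ?_
      have hx : 0 < x := hx
      rw [lintegral_Ioc_blissTail hr hx, ENNReal.ofReal_rpow_of_pos (by positivity),
        ← ENNReal.ofReal_mul (by positivity), blissHead, Real.mul_rpow (by positivity)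
        (by positivity), Real.rpow_sub hx, ← Real.rpow_mul (by positivity)]
      have : -(1 / r) * q = -(q / r) := by ring
      rw [this]
      field_simp
    · filter_upwards [ae_restrict_mem measurableSet_Ioi] with t ht using (blissHead_pos ht).le
  rw [hleft, lintegral_Ioi_blissTail_rpow hp1 hr hq, ENNReal.ofReal_rpow_of_pos hI0,
    ← ENNReal.ofReal_mul (by positivity), mul_assoc, ← Real.rpow_add hI0]
  have h7 : -r + q / p = 1 := by rw [hq]; field_simp; ring
  rw [h7, Real.rpow_one, hI01]
  congr 1
  field_simp

/-- Substitution `t = y^r/(1+y^r)`, written as `1 - (1+y^r)⁻¹`, which maps `(0, ∞)` bijectively onto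
`(0, 1)`. -/
theorem eulerBeta_eq_integral_blissTail {q r : ℝ} (hr : 0 < r) :
    eulerBeta (1 / r) ((q - 1) / r) = r * ∫ y in Ioi 0, blissTail r (q / r) y := by
  have himage : (fun y : ℝ ↦ 1 - (1 + y ^ r)⁻¹) '' Ioi 0 = Ioo 0 1 := by
    ext t
    simp only [mem_image, mem_Ioi, mem_Ioo]
    constructor
    · rintro ⟨y, hy, rfl⟩
      have h : 0 < y ^ r := Real.rpow_pos_of_pos hy r
      have h1 : (1 + y ^ r)⁻¹ < 1 := inv_lt_one_of_one_lt₀ (by linarith)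
      have h2 : 0 < (1 + y ^ r)⁻¹ := by positivity
      constructor <;> linarith
    · rintro ⟨h0, h1⟩
      have h2 : 0 < 1 - t := by linarith
      refine ⟨(t / (1 - t)) ^ (1 / r), by positivity, ?_⟩
      rw [← Real.rpow_mul (by positivity), one_div_mul_cancel hr.ne', Real.rpow_one]
      field_simp
      ring
  have hinj : InjOn (fun y : ℝ ↦ 1 - (1 + y ^ r)⁻¹) (Ioi 0) := by
    intro x hx y hy hxy
    have h1 : x ^ r = y ^ r := by
      have := sub_right_injective hxy
      linarith [inv_injective this]
    exact Real.rpow_left_injOn hr.ne' (mem_Ioi.1 hx).le (mem_Ioi.1 hy).le h1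
  have hderiv : ∀ y ∈ Ioi (0 : ℝ), HasDerivWithinAt (fun y : ℝ ↦ 1 - (1 + y ^ r)⁻¹)
      (r * y ^ (r - 1) / (1 + y ^ r) ^ 2) (Ioi 0) y := by
    intro y hy
    have hy : 0 < y := hy
    have h := (((Real.hasDerivAt_rpow_const (p := r) (Or.inl hy.ne')).const_add 1).fun_inv
      (by positivity)).const_sub 1
    refine (h.congr_deriv ?_).hasDerivWithinAt
    ring
  rw [eulerBeta, intervalIntegral.integral_of_le zero_le_one, integral_Ioc_eq_integral_Ioo,
    ← himage, integral_image_eq_integral_abs_deriv_smul measurableSet_Ioi hderiv hinj,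
    ← integral_const_mul]
  refine setIntegral_congr_fun measurableSet_Ioi fun y hy ↦ ?_
  have hy : 0 < y := hy
  have hD : 0 < 1 + y ^ r := by positivity
  have h1 : 1 - (1 + y ^ r)⁻¹ = y ^ r / (1 + y ^ r) := by field_simp; ring
  have h2 : 1 - (1 - (1 + y ^ r)⁻¹) = (1 + y ^ r)⁻¹ := by ring
  rw [h2, h1, abs_of_pos (by positivity), smul_eq_mul, mul_div_assoc, mul_assoc, blissTail]
  congr 1
  generalize 1 + y ^ r = D at hD
  rw [← Real.rpow_natCast D 2]
  obtain ⟨a, rfl⟩ : ∃ a, Real.exp a = D := ⟨_, Real.exp_log hD⟩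
  obtain ⟨b, rfl⟩ : ∃ a, Real.exp a = y := ⟨_, Real.exp_log hy⟩
  simp only [← Real.exp_sub, ← Real.exp_add, ← Real.exp_mul, ← Real.exp_neg]
  congr 1
  push_cast
  field_simp
  ring

/-! ### The substitution `t = r^n` -/

theorem setLIntegral_comp_pow_mul {n : ℕ} (hn : n ≠ 0) {s : Set ℝ} (hs : MeasurableSet s)
    (hs0 : s ⊆ Ioi 0) (h : ℝ → ℝ≥0∞) :
    ∫⁻ t in (fun r : ℝ ↦ r ^ n) '' s, h t =
      n * ∫⁻ r in s, h (r ^ n) * ENNReal.ofReal (r ^ (n - 1)) := by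
  rw [lintegral_image_eq_lintegral_abs_deriv_mul hs (f' := fun r ↦ n * r ^ (n - 1))
    (fun r _ ↦ (hasDerivAt_pow n r).hasDerivWithinAt)
    (fun x hx y hy hxy ↦ (pow_left_inj₀ (le_of_lt (hs0 hx)) (le_of_lt (hs0 hy)) hn).1 hxy),
    ← lintegral_const_mul' _ _ (by simp)]
  refine setLIntegral_congr_fun hs fun r hr ↦ ?_
  have : 0 < r := hs0 hr
  rw [abs_of_nonneg (by positivity), ENNReal.ofReal_mul (by positivity), ENNReal.ofReal_natCast]
  ring

theorem image_pow_Ioi {n : ℕ} (hn : n ≠ 0) : (fun r : ℝ ↦ r ^ n) '' Ioi 0 = Ioi 0 := by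
  ext t
  simp only [mem_image, mem_Ioi]
  refine ⟨fun ⟨r, hr, h⟩ ↦ h ▸ by positivity, fun ht ↦ ⟨t ^ ((n : ℝ)⁻¹), by positivity, ?_⟩⟩
  exact Real.rpow_inv_natCast_pow ht.le hn

theorem image_pow_Ioc {n : ℕ} (hn : n ≠ 0) {R : ℝ} (hR : 0 < R) :
    (fun r : ℝ ↦ r ^ n) '' Ioc 0 R = Ioc 0 (R ^ n) := by
  ext t
  simp only [mem_image, mem_Ioc]
  constructor
  · rintro ⟨r, ⟨hr, hrR⟩, rfl⟩
    exact ⟨by positivity, by gcongr⟩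
  · rintro ⟨ht, htR⟩
    have h := Real.rpow_inv_natCast_pow ht.le hn
    refine ⟨t ^ ((n : ℝ)⁻¹), ⟨by positivity, ?_⟩, h⟩
    rw [← h] at htR
    exact (pow_le_pow_iff_left₀ (by positivity) hR.le hn).1 htR

/-- Bliss's two functionals after the substitution `t = r^n`. -/
theorem lintegral_weighted_hardy_eq {n : ℕ} (hn : n ≠ 0) {q r : ℝ} (hq : 0 < q)
    (A : ℝ → ℝ≥0∞) :
    ∫⁻ R in Ioi 0, (ENNReal.ofReal ((R ^ n) ^ ((r - q) / q)) *
        ∫⁻ s in Ioc 0 R, A s * ENNReal.ofReal (s ^ (n - 1))) ^ q * ENNReal.ofReal (R ^ (n - 1)) =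
      (n : ℝ≥0∞) ^ (-q - 1) * ∫⁻ x in Ioi 0, (∫⁻ t in Ioc 0 x, A (t ^ ((n : ℝ)⁻¹))) ^ q *
        ENNReal.ofReal (x ^ (r - q)) := by
  have hn0 : (n : ℝ≥0∞) ≠ 0 := by exact_mod_cast hn
  have hnt : (n : ℝ≥0∞) ≠ ∞ := by simp
  conv_rhs => rw [← image_pow_Ioi hn, setLIntegral_comp_pow_mul hn measurableSet_Ioi subset_rfl,
    ← mul_assoc]
  -- The outer change of variables contributes one factor `n`; the inner one, raised to the power
  -- `q`, contributes `n^q`.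
  have h1 : (n : ℝ≥0∞) ^ (-q - 1) * n = (n : ℝ≥0∞) ^ (-q) := by
    conv_lhs => rw [← ENNReal.rpow_one (n : ℝ≥0∞), ← ENNReal.rpow_mul, ← ENNReal.rpow_add _ _ hn0 hnt]
    congr 1; ring
  rw [h1, ← lintegral_const_mul' _ _ (ENNReal.rpow_ne_top_of_ne_zero hn0 hnt)]
  refine setLIntegral_congr_fun measurableSet_Ioi fun R hR ↦ ?_
  have hR : 0 < R := hR
  have h2 : ∫⁻ t in Ioc 0 (R ^ n), A (t ^ ((n : ℝ)⁻¹)) =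
      n * ∫⁻ s in Ioc 0 R, A s * ENNReal.ofReal (s ^ (n - 1)) := by
    rw [← image_pow_Ioc hn hR, setLIntegral_comp_pow_mul hn measurableSet_Ioc Ioc_subset_Ioi_self]
    congr 1
    refine setLIntegral_congr_fun measurableSet_Ioc fun s hs ↦ ?_
    rw [Real.pow_rpow_inv_natCast hs.1.le hn]
  have h3 : ENNReal.ofReal ((R ^ n) ^ ((r - q) / q)) ^ q =
      ENNReal.ofReal ((R ^ n) ^ (r - q)) := by
    rw [ENNReal.ofReal_rpow_of_pos (by positivity), ← Real.rpow_mul (by positivity),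
      div_mul_cancel₀ _ hq.ne']
  rw [h2, ENNReal.mul_rpow_of_nonneg _ _ hq.le, ENNReal.mul_rpow_of_nonneg _ _ hq.le, h3]
  have h4 : (n : ℝ≥0∞) ^ (-q) * (n : ℝ≥0∞) ^ q = 1 := by
    rw [← ENNReal.rpow_add _ _ hn0 hnt]; simp
  calc _ = ((n : ℝ≥0∞) ^ (-q) * (n : ℝ≥0∞) ^ q) * (ENNReal.ofReal ((R ^ n) ^ (r - q)) *
        (∫⁻ s in Ioc 0 R, A s * ENNReal.ofReal (s ^ (n - 1))) ^ q * ENNReal.ofReal (R ^ (n - 1))) := by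
        rw [h4, one_mul]
    _ = _ := by ring

theorem lintegral_weighted_eq {n : ℕ} (hn : n ≠ 0) {p : ℝ} (A : ℝ → ℝ≥0∞) :
    ∫⁻ t in Ioi 0, A (t ^ ((n : ℝ)⁻¹)) ^ p =
      n * ∫⁻ s in Ioi 0, A s ^ p * ENNReal.ofReal (s ^ (n - 1)) := by
  conv_lhs => rw [← image_pow_Ioi hn, setLIntegral_comp_pow_mul hn measurableSet_Ioi subset_rfl]
  congr 1
  refine setLIntegral_congr_fun measurableSet_Ioi fun s hs ↦ ?_
  rw [Real.pow_rpow_inv_natCast (le_of_lt hs) hn]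

/-! ### Polar coordinates -/

section Polar

variable {n : ℕ}

local notation "𝔼" => EuclideanSpace ℝ (Fin n)

/-- Integration in polar coordinates. -/
theorem lintegral_polar [NeZero n] {h : 𝔼 → ℝ≥0∞} (hh : Measurable h) :
    ∫⁻ x, h x = ∫⁻ r in Ioi (0 : ℝ),
      (∫⁻ θ : Metric.sphere (0 : 𝔼) 1, h (r • (θ : 𝔼)) ∂(sphereMeasure n)) *
        ENNReal.ofReal (r ^ (n - 1)) := by
  have hdim : Module.finrank ℝ 𝔼 = n := by simp
  have hmp := (volume : Measure 𝔼).measurePreserving_homeomorphUnitSphereProd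
  rw [hdim] at hmp
  have hsm : Measurable fun z : Metric.sphere (0 : 𝔼) 1 × Ioi (0 : ℝ) ↦ h (z.2.1 • (z.1 : 𝔼)) :=
    hh.comp (by fun_prop)
  calc ∫⁻ x, h x = ∫⁻ x : ({0}ᶜ : Set 𝔼), h x.1 ∂((volume : Measure 𝔼).comap (↑)) := by
        rw [lintegral_subtype_comap (measurableSet_singleton _).compl h, restrict_compl_singleton]
    _ = ∫⁻ z, h (z.2.1 • (z.1 : 𝔼)) ∂((volume : Measure 𝔼).toSphere.prod
          (Measure.volumeIoiPow (n - 1))) := by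
        rw [← hmp.lintegral_comp hsm]
        refine lintegral_congr fun x ↦ ?_
        have hx : ‖(x : 𝔼)‖ ≠ 0 := norm_ne_zero_iff.2 x.2
        simp [smul_smul, hx]
    _ = ∫⁻ r : Ioi (0 : ℝ), (∫⁻ θ : Metric.sphere (0 : 𝔼) 1, h (r.1 • (θ : 𝔼))
          ∂(sphereMeasure n)) ∂(Measure.volumeIoiPow (n - 1)) := by
        rw [lintegral_prod_symm _ hsm.aemeasurable]; rfl
    _ = _ := by
        have : SFinite (sphereMeasure n) := by unfold sphereMeasure; infer_instance
        have hin : Measurable fun r : Ioi (0 : ℝ) ↦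
            ∫⁻ θ : Metric.sphere (0 : 𝔼) 1, h (r.1 • (θ : 𝔼)) ∂(sphereMeasure n) :=
          hsm.lintegral_prod_left'
        rw [Measure.volumeIoiPow, lintegral_withDensity_eq_lintegral_mul _ (by fun_prop) hin]
        rw [← lintegral_subtype_comap measurableSet_Ioi]
        refine lintegral_congr fun r ↦ ?_
        simp [mul_comm]

instance : IsFiniteMeasure (sphereMeasure n) := by unfold sphereMeasure; infer_instance

theorem measurable_lintegral_sphere {h : 𝔼 → ℝ≥0∞} (hh : Measurable h) :
    Measurable fun r : ℝ ↦ ∫⁻ θ : Metric.sphere (0 : 𝔼) 1, h (r • (θ : 𝔼)) ∂(sphereMeasure n) := by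
  have : Measurable fun z : ℝ × Metric.sphere (0 : 𝔼) 1 ↦ h (z.1 • (z.2 : 𝔼)) :=
    hh.comp (by fun_prop)
  exact this.lintegral_prod_right'

/-- By polar integration a null set meets almost every sphere in a null set. This allows passing to
a measurable representative inside the iterated integrals of the mixed norm. -/
theorem ae_ae_sphere_of_ae [NeZero n] {P : 𝔼 → Prop} (hP : ∀ᵐ x, P x) :
    ∀ᵐ r ∂(volume.restrict (Ioi (0 : ℝ))), ∀ᵐ θ : Metric.sphere (0 : 𝔼) 1 ∂(sphereMeasure n),
      P (r • (θ : 𝔼)) := by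
  obtain ⟨s, hs, hsm, hs0⟩ := exists_measurable_superset_of_null (ae_iff.1 hP)
  have h1 : Measurable (s.indicator (1 : 𝔼 → ℝ≥0∞)) := measurable_one.indicator hsm
  have h2 := lintegral_polar h1
  have h6 : Measurable fun r : ℝ ↦ (∫⁻ θ : Metric.sphere (0 : 𝔼) 1,
      s.indicator (1 : 𝔼 → ℝ≥0∞) (r • (θ : 𝔼)) ∂(sphereMeasure n)) * ENNReal.ofReal (r ^ (n - 1)) :=
    (measurable_lintegral_sphere h1).mul (by fun_prop)
  rw [lintegral_indicator_one hsm, hs0, eq_comm, lintegral_eq_zero_iff h6] at h2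
  filter_upwards [h2, ae_restrict_mem measurableSet_Ioi] with r hr hr0
  have hr0 : 0 < r := hr0
  have h3 : ENNReal.ofReal (r ^ (n - 1)) ≠ 0 := by
    rw [Ne, ENNReal.ofReal_eq_zero, not_le]; positivity
  have h4 := (mul_eq_zero.1 hr).resolve_right h3
  have h5 : Measurable fun θ : Metric.sphere (0 : 𝔼) 1 ↦
      s.indicator (1 : 𝔼 → ℝ≥0∞) (r • (θ : 𝔼)) := h1.comp (by fun_prop)
  rw [lintegral_eq_zero_iff h5] at h4
  filter_upwards [h4] with θ hθ
  by_contra hc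
  have : r • (θ : 𝔼) ∈ s := hs hc
  simp [this] at hθ

theorem setLIntegral_closedBall_polar [NeZero n] {h : 𝔼 → ℝ≥0∞} (hh : Measurable h) (R : ℝ) :
    ∫⁻ y in {y : 𝔼 | ‖y‖ ≤ R}, h y = ∫⁻ s in Ioc 0 R,
      (∫⁻ θ : Metric.sphere (0 : 𝔼) 1, h (s • (θ : 𝔼)) ∂(sphereMeasure n)) *
        ENNReal.ofReal (s ^ (n - 1)) := by
  have hm : MeasurableSet {y : 𝔼 | ‖y‖ ≤ R} := measurableSet_le measurable_norm measurable_const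
  rw [← lintegral_indicator hm, lintegral_polar (hh.indicator hm), ← Ioi_inter_Iic,
    inter_comm, ← setLIntegral_indicator measurableSet_Iic]
  refine setLIntegral_congr_fun measurableSet_Ioi fun r hr ↦ ?_
  have hr : 0 < r := hr
  have h1 : ∀ θ : Metric.sphere (0 : 𝔼) 1, ‖r • (θ : 𝔼)‖ = r := fun θ ↦ by
    rw [norm_smul, norm_eq_of_mem_sphere, mul_one, Real.norm_of_nonneg hr.le]
  by_cases hrR : r ≤ R
  · simp [indicator, h1, hrR]
  · simp [indicator, h1, hrR]

end Polar

/-! ### The weighted radial form of Bliss's inequality -/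

/-- The constant in the weighted form of Bliss's inequality. -/
noncomputable def weightedBlissConst (n : ℕ) (p' q r : ℝ) : ℝ≥0∞ :=
  ((n : ℝ≥0∞) ^ (r - q) *
    ENNReal.ofReal (p' / q * (∫ y in Ioi 0, blissTail r (q / r) y) ^ (-r))) ^ (1 / q)

/-- The radial part of the mixed norm of the Hardy transform of a radial profile `A`. -/
noncomputable def radialHardyNorm (n : ℕ) (q r : ℝ) (A : ℝ → ℝ≥0∞) : ℝ≥0∞ :=
  (∫⁻ R in Ioi 0, (ENNReal.ofReal ((R ^ n) ^ ((r - q) / q)) *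
    ∫⁻ s in Ioc 0 R, A s * ENNReal.ofReal (s ^ (n - 1))) ^ q *
      ENNReal.ofReal (R ^ (n - 1))) ^ (1 / q)

/-- The radial part of the mixed norm of a radial profile `A`. -/
noncomputable def radialNorm (n : ℕ) (p : ℝ) (A : ℝ → ℝ≥0∞) : ℝ≥0∞ :=
  (∫⁻ R in Ioi 0, A R ^ p * ENNReal.ofReal (R ^ (n - 1))) ^ (1 / p)

/-- Bookkeeping shared by the inequality and its equality case; the power of `n` is `-q - 1 + q/p =
r - q`. -/
theorem weightedBlissConst_mul {n : ℕ} (hn : n ≠ 0) {p p' q r : ℝ} (hp : 1 < p)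
    (hr : 0 < r) (hq : q = p * (r + 1)) (N : ℝ≥0∞) :
    ((n : ℝ≥0∞) ^ (-q - 1) * (ENNReal.ofReal (p' / q *
      (∫ y in Ioi 0, blissTail r (q / r) y) ^ (-r)) * (n * N) ^ (q / p))) ^ (1 / q) =
    weightedBlissConst n p' q r * N ^ (1 / p) := by
  have hq0 : 0 < q := by rw [hq]; positivity
  have hn0 : (n : ℝ≥0∞) ≠ 0 := by exact_mod_cast hn
  have hnt : (n : ℝ≥0∞) ≠ ∞ := by simp
  rw [weightedBlissConst]
  generalize ENNReal.ofReal (p' / q * (∫ y in Ioi 0, blissTail r (q / r) y) ^ (-r)) = k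
  have h1 : N ^ (1 / p) = (N ^ (q / p)) ^ (1 / q) := by
    rw [← ENNReal.rpow_mul]; congr 1; field_simp
  rw [h1, ← ENNReal.mul_rpow_of_nonneg _ _ (by positivity),
    ENNReal.mul_rpow_of_nonneg (n : ℝ≥0∞) N (z := q / p) (by positivity)]
  congr 1
  have h2 : (n : ℝ≥0∞) ^ (r - q) = (n : ℝ≥0∞) ^ (-q - 1) * (n : ℝ≥0∞) ^ (q / p) := by
    rw [← ENNReal.rpow_add _ _ hn0 hnt, hq]
    congr 1; field_simp; ring
  rw [h2]
  ring

theorem radialHardyNorm_le {n : ℕ} (hn : n ≠ 0) {p p' q r : ℝ} (hp : p.HolderConjugate p')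
    (hr : 0 < r) (hq : q = p * (r + 1)) {A : ℝ → ℝ≥0∞} (hA : Measurable A) :
    radialHardyNorm n q r A ≤ weightedBlissConst n p' q r * radialNorm n p A := by
  have hp0 := hp.pos
  have hq0 : 0 < q := by rw [hq]; positivity
  rw [radialNorm, ← weightedBlissConst_mul hn hp.lt hr hq, ← lintegral_weighted_eq hn,
    radialHardyNorm, lintegral_weighted_hardy_eq hn hq0]
  gcongr
  exact lintegral_bliss hp hr hq (hA.comp (by fun_prop)).aemeasurable

theorem radialHardyNorm_extremal {n : ℕ} (hn : n ≠ 0) {p p' q r : ℝ}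
    (hp : p.HolderConjugate p') (hr : 0 < r) (hq : q = p * (r + 1)) :
    radialHardyNorm n q r (fun s ↦ ENNReal.ofReal (blissTail r ((r + 1) / r) (s ^ n))) =
      weightedBlissConst n p' q r *
        radialNorm n p (fun s ↦ ENNReal.ofReal (blissTail r ((r + 1) / r) (s ^ n))) := by
  have hp0 := hp.pos
  have hq0 : 0 < q := by rw [hq]; positivity
  rw [radialNorm, ← weightedBlissConst_mul hn hp.lt hr hq, ← lintegral_weighted_eq hn,
    radialHardyNorm, lintegral_weighted_hardy_eq hn hq0]
  have h1 : ∀ t : ℝ, 0 < t → (t ^ ((n : ℝ)⁻¹)) ^ n = t := fun t ht ↦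
    Real.rpow_inv_natCast_pow ht.le hn
  have h2 := lintegral_bliss_extremal hp hr hq
  have h3 : ∫⁻ t in Ioi 0, ENNReal.ofReal (blissTail r ((r + 1) / r) ((t ^ ((n : ℝ)⁻¹)) ^ n)) ^ p =
      ∫⁻ t in Ioi 0, ENNReal.ofReal (blissTail r ((r + 1) / r) t) ^ p :=
    setLIntegral_congr_fun measurableSet_Ioi fun t ht ↦ by rw [h1 t ht]
  have h4 : ∀ x, ∫⁻ t in Ioc 0 x,
      ENNReal.ofReal (blissTail r ((r + 1) / r) ((t ^ ((n : ℝ)⁻¹)) ^ n)) =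
      ∫⁻ t in Ioc 0 x, ENNReal.ofReal (blissTail r ((r + 1) / r) t) := fun x ↦
    setLIntegral_congr_fun measurableSet_Ioc fun t ht ↦ by rw [h1 t ht.1]
  simp only [h3, h4, h2]

theorem radialNorm_extremal_ne {n : ℕ} (hn : n ≠ 0) {p q r : ℝ}
    (hp : 1 < p) (hr : 0 < r) (hq : q = p * (r + 1)) :
    radialNorm n p (fun s ↦ ENNReal.ofReal (blissTail r ((r + 1) / r) (s ^ n))) ≠ 0 ∧
    radialNorm n p (fun s ↦ ENNReal.ofReal (blissTail r ((r + 1) / r) (s ^ n))) ≠ ∞ := by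
  have hq0 : 0 < q := by rw [hq]; positivity
  have hN0 : 0 ≤ q / r := by positivity
  have hrN : r * (q / r) = q := by field_simp
  have hN : 1 + r < r * (q / r) := by rw [hrN, hq]; nlinarith
  have hI0 : 0 < ∫ y in Ioi 0, blissTail r (q / r) y := by
    rw [integral_Ioi_blissTail hr hN0 hN]
    exact mul_pos (by linarith) (integral_Ioi_blissHead_pos hr hN0 hN)
  have hn0 : (n : ℝ≥0∞) ≠ 0 := by exact_mod_cast hn
  have h1 : ∀ t : ℝ, 0 < t → (t ^ ((n : ℝ)⁻¹)) ^ n = t := fun t ht ↦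
    Real.rpow_inv_natCast_pow ht.le hn
  have h2 := lintegral_weighted_eq hn (p := p)
    (fun s ↦ ENNReal.ofReal (blissTail r ((r + 1) / r) (s ^ n)))
  have h3 : ∫⁻ t in Ioi 0, ENNReal.ofReal (blissTail r ((r + 1) / r) ((t ^ ((n : ℝ)⁻¹)) ^ n)) ^ p =
      ∫⁻ t in Ioi 0, ENNReal.ofReal (blissTail r ((r + 1) / r) t) ^ p :=
    setLIntegral_congr_fun measurableSet_Ioi fun t ht ↦ by rw [h1 t ht]
  rw [h3, lintegral_Ioi_blissTail_rpow hp hr hq] at h2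
  have h4 : ∫⁻ s in Ioi 0, ENNReal.ofReal (blissTail r ((r + 1) / r) (s ^ n)) ^ p *
      ENNReal.ofReal (s ^ (n - 1)) ≠ 0 := by
    intro h
    rw [h, mul_zero, ENNReal.ofReal_eq_zero] at h2
    linarith
  have h5 : ∫⁻ s in Ioi 0, ENNReal.ofReal (blissTail r ((r + 1) / r) (s ^ n)) ^ p *
      ENNReal.ofReal (s ^ (n - 1)) ≠ ∞ := by
    intro h
    rw [h, ENNReal.mul_top hn0] at h2
    exact ENNReal.ofReal_ne_top h2
  exact ⟨(ENNReal.rpow_pos (pos_iff_ne_zero.2 h4) h5).ne',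
    ENNReal.rpow_ne_top_of_nonneg (by positivity) h5⟩

theorem lintegral_const_mul_rpow_rpow {q : ℝ} (hq : 0 < q) {c : ℝ≥0∞} (hc : c ≠ ∞)
    (X w : ℝ → ℝ≥0∞) :
    (∫⁻ R in Ioi 0, (c * X R) ^ q * w R) ^ (1 / q) =
      c * (∫⁻ R in Ioi 0, X R ^ q * w R) ^ (1 / q) := by
  simp_rw [ENNReal.mul_rpow_of_nonneg _ _ hq.le, mul_assoc]
  rw [lintegral_const_mul' _ _ (ENNReal.rpow_ne_top_of_nonneg hq.le hc),
    ENNReal.mul_rpow_of_nonneg _ _ (by positivity), ← ENNReal.rpow_mul,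
    mul_one_div_cancel hq.ne', ENNReal.rpow_one]

/-! ### Radial functions, the sphere estimate and the extremal -/

section Radial

variable {n : ℕ} {𝕜 : Type*} [RCLike 𝕜]

local notation "𝔼" => EuclideanSpace ℝ (Fin n)

theorem norm_smul_sphere {r : ℝ} (hr : 0 < r) (θ : Metric.sphere (0 : 𝔼) 1) :
    ‖r • (θ : 𝔼)‖ = r := by
  rw [norm_smul, norm_eq_of_mem_sphere, mul_one, Real.norm_of_nonneg hr.le]

theorem angNorm_of_radial {q : ℝ} (hq : 0 < q) (φ : ℝ → 𝕜) {r : ℝ} (hr : 0 < r) :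
    angNorm q (fun x : 𝔼 ↦ φ ‖x‖) r = sphereMeasure n univ ^ (1 / q) * ‖φ r‖ₑ := by
  simp_rw [angNorm, norm_smul_sphere hr]
  rw [lintegral_const, ENNReal.mul_rpow_of_nonneg _ _ (by positivity), ← ENNReal.rpow_mul,
    mul_one_div_cancel hq.ne', ENNReal.rpow_one, mul_comm]

theorem radAngNorm_of_radial {p q : ℝ} (hp : 0 < p) (hq : 0 < q) (φ : ℝ → 𝕜) :
    radAngNorm p q (fun x : 𝔼 ↦ φ ‖x‖) =
      sphereMeasure n univ ^ (1 / q) * radialNorm n p fun r ↦ ‖φ r‖ₑ := by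
  rw [radialNorm, ← lintegral_const_mul_rpow_rpow hp
    (ENNReal.rpow_ne_top_of_nonneg (by positivity) (measure_ne_top _ _)), radAngNorm]
  congr 1
  refine setLIntegral_congr_fun measurableSet_Ioi fun r hr ↦ ?_
  rw [angNorm_of_radial hq φ hr]

/-- The radial profile of the fractional Hardy transform. -/
noncomputable def fracHardyProfile (β : ℝ) (f : 𝔼 → 𝕜) (R : ℝ) : 𝕜 :=
  (1 / volume.real (Metric.ball (0 : 𝔼) R) ^ (1 - β / n)) • ∫ y in {y : 𝔼 | ‖y‖ ≤ R}, f y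

theorem volume_real_ball_zero [NeZero n] {R : ℝ} (hR : 0 ≤ R) :
    volume.real (Metric.ball (0 : 𝔼) R) = R ^ n * volume.real (Metric.ball (0 : 𝔼) 1) := by
  rw [measureReal_def, Measure.addHaar_ball _ _ hR, ENNReal.toReal_mul, measureReal_def,
    ENNReal.toReal_ofReal (by positivity)]
  simp

/-- The integral over `‖y‖ ≤ ‖x‖` is a partial integral of a jointly measurable function of `(x,
y)`. -/
theorem aestronglyMeasurable_fracHardy [NeZero n] (β : ℝ) {f : 𝔼 → 𝕜}
    (hf : AEStronglyMeasurable f volume) : AEStronglyMeasurable (fracHardy β f) volume := by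
  obtain ⟨g, hg, hfg⟩ := hf
  have h1 : ∀ x : 𝔼, ∫ y in {y : 𝔼 | ‖y‖ ≤ ‖x‖}, f y =
      ∫ y, {z : 𝔼 × 𝔼 | ‖z.2‖ ≤ ‖z.1‖}.indicator (fun z ↦ g z.2) (x, y) := fun x ↦ by
    rw [integral_congr_ae (ae_restrict_of_ae hfg),
      ← integral_indicator (measurableSet_le measurable_norm measurable_const)]
    rfl
  have h2 : StronglyMeasurable fun x : 𝔼 ↦ ∫ y in {y : 𝔼 | ‖y‖ ≤ ‖x‖}, f y := by
    simp_rw [h1]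
    refine StronglyMeasurable.integral_prod_right' (f := {z : 𝔼 × 𝔼 | ‖z.2‖ ≤ ‖z.1‖}.indicator
      fun z ↦ g z.2) ?_
    exact (hg.comp_measurable measurable_snd).indicator
      (measurableSet_le (by fun_prop) (by fun_prop))
  have h3 : Measurable fun x : 𝔼 ↦ 1 / volume.real (Metric.ball (0 : 𝔼) ‖x‖) ^ (1 - β / n) := by
    simp_rw [volume_real_ball_zero (norm_nonneg _)]
    fun_prop
  exact (h3.stronglyMeasurable.smul h2).aestronglyMeasurable

/-- Hölder against the constant `1`; nothing is lost on constants, hence nothing on radial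
functions. -/
theorem lintegral_sphere_le {q : ℝ} (hq : 1 < q) {h : Metric.sphere (0 : 𝔼) 1 → ℝ≥0∞}
    (hh : Measurable h) :
    ∫⁻ θ, h θ ∂(sphereMeasure n) ≤
      sphereMeasure n univ ^ (1 - 1 / q) * (∫⁻ θ, h θ ^ q ∂(sphereMeasure n)) ^ (1 / q) := by
  have hqq := Real.HolderConjugate.conjExponent hq
  have := ENNReal.lintegral_mul_le_Lp_mul_Lq (sphereMeasure n) hqq hh.aemeasurable
    (aemeasurable_const (b := (1 : ℝ≥0∞)))
  simp only [Pi.mul_apply, mul_one, ENNReal.one_rpow, lintegral_const, one_mul] at this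
  rw [mul_comm] at this
  have h1 : 1 / q.conjExponent = 1 - 1 / q := by
    have := hqq.inv_add_inv_eq_one
    rw [one_div, one_div]; linarith
  rwa [h1] at this

/-- The factor coming from the angular variables and the normalisation of the Hardy operator. -/
noncomputable def angularConst (n : ℕ) (β q₁ q₂ : ℝ) : ℝ≥0∞ :=
  sphereMeasure n univ ^ (1 / q₂) *
    (ENNReal.ofReal (volume.real (Metric.ball (0 : EuclideanSpace ℝ (Fin n)) 1) ^ (-(1 - β / n))) *
      sphereMeasure n univ ^ (1 - 1 / q₁))

/-- With `r = p₂β/n` the weight exponent `(r - p₂)/p₂` of the radial problem is `-(1 - β/n)`, the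
power in the Hardy operator. -/
theorem enorm_fracHardy_factor [NeZero n] {β p₂ R : ℝ} (hp₂ : 1 < p₂) (hR : 0 < R) :
    ‖1 / volume.real (Metric.ball (0 : 𝔼) R) ^ (1 - β / n)‖ₑ =
      ENNReal.ofReal (volume.real (Metric.ball (0 : 𝔼) 1) ^ (-(1 - β / n))) *
        ENNReal.ofReal ((R ^ n) ^ ((p₂ * β / n - p₂) / p₂)) := by
  have h1 : (p₂ * β / n - p₂) / p₂ = -(1 - β / n) := by field_simp; ring
  have hv : 0 ≤ volume.real (Metric.ball (0 : 𝔼) 1) := measureReal_nonneg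
  rw [volume_real_ball_zero hR.le, Real.enorm_of_nonneg (by positivity),
    ← ENNReal.ofReal_mul (by positivity), h1, Real.mul_rpow (by positivity) hv,
    Real.rpow_neg hv, Real.rpow_neg (by positivity)]
  congr 1
  field_simp

theorem radAngNorm_fracHardy_le [NeZero n] {β p₁ q₁ p₂ q₂ : ℝ} (hβ : 0 < β)
    (hp₁ : 1 < p₁) (hq₁ : 1 < q₁) (hp₂ : 1 < p₂) (hq₂ : 1 < q₂)
    (hp : p₂ = p₁ * (p₂ * β / n + 1)) {f : 𝔼 → 𝕜} (hf : AEStronglyMeasurable f volume) :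
    radAngNorm p₂ q₂ (fracHardy β f) ≤
      angularConst n β q₁ q₂ * weightedBlissConst n p₁.conjExponent p₂ (p₂ * β / n) *
        radAngNorm p₁ q₁ f := by
  have hn : n ≠ 0 := NeZero.ne n
  have hn0 : (0 : ℝ) < n := by exact_mod_cast Nat.pos_of_ne_zero hn
  have hconj := Real.HolderConjugate.conjExponent hp₁
  have hωt : sphereMeasure n univ ≠ ∞ := measure_ne_top _ _
  -- The profile `A` is built from a measurable version `h` of `‖f‖ₑ`, so that it is itself
  -- measurable.
  obtain ⟨h, hh, hfh⟩ := hf.enorm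
  set A : ℝ → ℝ≥0∞ := fun s ↦
    (∫⁻ θ : Metric.sphere (0 : 𝔼) 1, h (s • (θ : 𝔼)) ^ q₁ ∂(sphereMeasure n)) ^ (1 / q₁) with hA
  have hAm : Measurable A :=
    (measurable_lintegral_sphere (h := fun x ↦ h x ^ q₁) (hh.pow_const q₁)).pow_const _
  have hAf : radialNorm n p₁ A = radAngNorm p₁ q₁ f := by
    rw [radialNorm, radAngNorm]
    congr 1
    refine lintegral_congr_ae ?_
    filter_upwards [ae_ae_sphere_of_ae hfh] with s hs
    congr 2
    simp only [hA, angNorm]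
    congr 1
    refine lintegral_congr_ae ?_
    filter_upwards [hs] with θ hθ
    rw [hθ]
  have hprofile : ∀ R, 0 < R → sphereMeasure n univ ^ (1 / q₂) * ‖fracHardyProfile β f R‖ₑ ≤
      angularConst n β q₁ q₂ * (ENNReal.ofReal ((R ^ n) ^ ((p₂ * β / n - p₂) / p₂)) *
        ∫⁻ s in Ioc 0 R, A s * ENNReal.ofReal (s ^ (n - 1))) := by
    intro R hR
    have h1 : ‖∫ y in {y : 𝔼 | ‖y‖ ≤ R}, f y‖ₑ ≤ sphereMeasure n univ ^ (1 - 1 / q₁) *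
        ∫⁻ s in Ioc 0 R, A s * ENNReal.ofReal (s ^ (n - 1)) := by
      calc _ ≤ ∫⁻ y in {y : 𝔼 | ‖y‖ ≤ R}, ‖f y‖ₑ := enorm_integral_le_lintegral_enorm _
        _ = ∫⁻ y in {y : 𝔼 | ‖y‖ ≤ R}, h y := lintegral_congr_ae (ae_restrict_of_ae hfh)
        _ = _ := setLIntegral_closedBall_polar hh R
        _ ≤ ∫⁻ s in Ioc 0 R, sphereMeasure n univ ^ (1 - 1 / q₁) *
              (A s * ENNReal.ofReal (s ^ (n - 1))) := by
            refine lintegral_mono fun s ↦ ?_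
            rw [← mul_assoc]
            gcongr
            exact lintegral_sphere_le hq₁ (hh.comp (by fun_prop))
        _ = _ := lintegral_const_mul' _ _ (ENNReal.rpow_ne_top_of_nonneg
            (by rw [sub_nonneg, div_le_one] <;> linarith) hωt)
    rw [fracHardyProfile, enorm_smul, enorm_fracHardy_factor hp₂ hR, angularConst]
    calc _ ≤ sphereMeasure n univ ^ (1 / q₂) *
          (ENNReal.ofReal (volume.real (Metric.ball (0 : 𝔼) 1) ^ (-(1 - β / n))) *
            ENNReal.ofReal ((R ^ n) ^ ((p₂ * β / n - p₂) / p₂)) *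
            (sphereMeasure n univ ^ (1 - 1 / q₁) *
              ∫⁻ s in Ioc 0 R, A s * ENNReal.ofReal (s ^ (n - 1)))) := by gcongr
      _ = _ := by ring
  have hct : angularConst n β q₁ q₂ ≠ ∞ := by
    refine ENNReal.mul_ne_top (ENNReal.rpow_ne_top_of_nonneg (by positivity) hωt)
      (ENNReal.mul_ne_top ENNReal.ofReal_ne_top (ENNReal.rpow_ne_top_of_nonneg ?_ hωt))
    rw [sub_nonneg, div_le_one] <;> linarith
  calc radAngNorm p₂ q₂ (fracHardy β f)
      = sphereMeasure n univ ^ (1 / q₂) * radialNorm n p₂ fun r ↦ ‖fracHardyProfile β f r‖ₑ :=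
        radAngNorm_of_radial (by linarith) (by linarith) (fracHardyProfile β f)
    _ = (∫⁻ R in Ioi 0, (sphereMeasure n univ ^ (1 / q₂) * ‖fracHardyProfile β f R‖ₑ) ^ p₂ *
          ENNReal.ofReal (R ^ (n - 1))) ^ (1 / p₂) :=
        (lintegral_const_mul_rpow_rpow (by linarith)
          (ENNReal.rpow_ne_top_of_nonneg (by positivity) hωt) _ _).symm
    _ ≤ (∫⁻ R in Ioi 0, (angularConst n β q₁ q₂ *
          (ENNReal.ofReal ((R ^ n) ^ ((p₂ * β / n - p₂) / p₂)) *
            ∫⁻ s in Ioc 0 R, A s * ENNReal.ofReal (s ^ (n - 1)))) ^ p₂ *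
          ENNReal.ofReal (R ^ (n - 1))) ^ (1 / p₂) := by
        refine ENNReal.rpow_le_rpow (setLIntegral_mono' measurableSet_Ioi fun R hR ↦ ?_)
          (by positivity)
        gcongr ?_ * _
        exact ENNReal.rpow_le_rpow (hprofile R hR) (by linarith)
    _ = angularConst n β q₁ q₂ * radialHardyNorm n p₂ (p₂ * β / n) A :=
        lintegral_const_mul_rpow_rpow (by linarith) hct _ _
    _ ≤ _ := by
        rw [mul_assoc, ← hAf]
        gcongr
        exact radialHardyNorm_le hn hconj (by positivity) hp hAm

/-- The radial function for which the fractional Hardy inequality is an equality. -/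
noncomputable def hardyExtremal (n : ℕ) (𝕜 : Type*) [RCLike 𝕜] (r : ℝ)
    (x : EuclideanSpace ℝ (Fin n)) : 𝕜 :=
  ((blissTail r ((r + 1) / r) (‖x‖ ^ n) : ℝ) : 𝕜)

theorem continuous_blissTail_norm_pow {r : ℝ} (N : ℝ) (hr : 0 < r) :
    Continuous fun x : 𝔼 ↦ blissTail r N (‖x‖ ^ n) :=
  (continuousOn_blissTail N hr).comp_continuous (by fun_prop)
    fun x ↦ mem_Ici.2 (pow_nonneg (norm_nonneg x) n)

theorem radAngNorm_hardyExtremal {p q r : ℝ} (hp : 0 < p) (hq : 0 < q) :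
    radAngNorm p q (hardyExtremal n 𝕜 r) = sphereMeasure n univ ^ (1 / q) *
      radialNorm n p fun s ↦ ENNReal.ofReal (blissTail r ((r + 1) / r) (s ^ n)) := by
  have h := radAngNorm_of_radial (n := n) hp hq
    (fun s ↦ ((blissTail r ((r + 1) / r) (s ^ n) : ℝ) : 𝕜))
  refine h.trans ?_
  congr 1
  rw [radialNorm, radialNorm]
  congr 1
  refine setLIntegral_congr_fun measurableSet_Ioi fun s hs ↦ ?_
  have hs : 0 < s := hs
  rw [← ofReal_norm, RCLike.norm_ofReal, abs_of_pos (blissTail_pos (by positivity))]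

theorem enorm_setIntegral_hardyExtremal [NeZero n] {r : ℝ} (hr : 0 < r) (R : ℝ) :
    ‖∫ y in {y : 𝔼 | ‖y‖ ≤ R}, hardyExtremal n 𝕜 r y‖ₑ = sphereMeasure n univ *
      ∫⁻ s in Ioc 0 R, ENNReal.ofReal (blissTail r ((r + 1) / r) (s ^ n)) *
        ENNReal.ofReal (s ^ (n - 1)) := by
  have hc := continuous_blissTail_norm_pow (n := n) ((r + 1) / r) hr
  have hpos : ∀ x : 𝔼, 0 ≤ blissTail r ((r + 1) / r) (‖x‖ ^ n) := fun x ↦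
    (blissTail_pos (by positivity)).le
  have hset : {y : 𝔼 | ‖y‖ ≤ R} = Metric.closedBall 0 R := by ext; simp
  have hi : IntegrableOn (fun x : 𝔼 ↦ blissTail r ((r + 1) / r) (‖x‖ ^ n)) {y : 𝔼 | ‖y‖ ≤ R} := by
    rw [hset]; exact hc.continuousOn.integrableOn_compact (isCompact_closedBall _ _)
  have h1 : ‖∫ y in {y : 𝔼 | ‖y‖ ≤ R}, hardyExtremal n 𝕜 r y‖ₑ =
      ∫⁻ y in {y : 𝔼 | ‖y‖ ≤ R}, ENNReal.ofReal (blissTail r ((r + 1) / r) (‖y‖ ^ n)) := by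
    simp only [hardyExtremal]
    rw [integral_ofReal, ← ofReal_norm, RCLike.norm_ofReal,
      abs_of_nonneg (integral_nonneg hpos), ofReal_integral_eq_lintegral_ofReal hi
        (Eventually.of_forall hpos)]
  rw [h1, setLIntegral_closedBall_polar hc.measurable.ennreal_ofReal,
    ← lintegral_const_mul' _ _ (measure_ne_top _ _)]
  refine setLIntegral_congr_fun measurableSet_Ioc fun s hs ↦ ?_
  simp only [norm_smul_sphere hs.1, lintegral_const]
  ring

/-- The function is radial and positive, so Hölder on the sphere and the triangle inequality for the
integral are equalities, and its profile is extremal for Bliss. -/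
theorem radAngNorm_fracHardy_hardyExtremal [NeZero n] {β p₁ q₁ p₂ q₂ : ℝ} (hβ : 0 < β)
    (hp₁ : 1 < p₁) (hq₁ : 1 < q₁) (hp₂ : 1 < p₂) (hq₂ : 1 < q₂)
    (hp : p₂ = p₁ * (p₂ * β / n + 1)) :
    radAngNorm p₂ q₂ (fracHardy β (hardyExtremal n 𝕜 (p₂ * β / n))) =
      angularConst n β q₁ q₂ * weightedBlissConst n p₁.conjExponent p₂ (p₂ * β / n) *
        radAngNorm p₁ q₁ (hardyExtremal n 𝕜 (p₂ * β / n)) := by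
  have hn : n ≠ 0 := NeZero.ne n
  have hn0 : (0 : ℝ) < n := by exact_mod_cast Nat.pos_of_ne_zero hn
  have hconj := Real.HolderConjugate.conjExponent hp₁
  have hωt : sphereMeasure n univ ≠ ∞ := measure_ne_top _ _
  have hr : 0 < p₂ * β / n := by positivity
  set r := p₂ * β / n with hrdef
  set A : ℝ → ℝ≥0∞ := fun s ↦ ENNReal.ofReal (blissTail r ((r + 1) / r) (s ^ n)) with hA
  set v := ENNReal.ofReal (volume.real (Metric.ball (0 : 𝔼) 1) ^ (-(1 - β / n))) with hv
  -- One factor `ω_n` from the angular integral splits into the Hölder constant and the angular norm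
  -- of a constant.
  have hωsplit : sphereMeasure n univ =
      sphereMeasure n univ ^ (1 - 1 / q₁) * sphereMeasure n univ ^ (1 / q₁) := by
    rw [← ENNReal.rpow_add_of_nonneg _ _ (by rw [sub_nonneg, div_le_one] <;> linarith)
      (by positivity)]
    simp
  calc radAngNorm p₂ q₂ (fracHardy β (hardyExtremal n 𝕜 r))
      = sphereMeasure n univ ^ (1 / q₂) *
          radialNorm n p₂ fun R ↦ ‖fracHardyProfile β (hardyExtremal n 𝕜 r) R‖ₑ :=
        radAngNorm_of_radial (by linarith) (by linarith) (fracHardyProfile β _)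
    _ = sphereMeasure n univ ^ (1 / q₂) *
          (v * sphereMeasure n univ * radialHardyNorm n p₂ r A) := by
        rw [radialHardyNorm, ← lintegral_const_mul_rpow_rpow (by linarith)
          (ENNReal.mul_ne_top ENNReal.ofReal_ne_top hωt), radialNorm]
        congr 2
        refine setLIntegral_congr_fun measurableSet_Ioi fun R hR ↦ ?_
        rw [fracHardyProfile, enorm_smul, enorm_fracHardy_factor hp₂ hR,
          enorm_setIntegral_hardyExtremal hr]
        congr 2
        ring
    _ = _ := by
        rw [radialHardyNorm_extremal hn hconj hr hp, radAngNorm_hardyExtremal (by linarith)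
          (by linarith), angularConst, ← hv]
        calc sphereMeasure n univ ^ (1 / q₂) * (v * sphereMeasure n univ *
              (weightedBlissConst n p₁.conjExponent p₂ r * radialNorm n p₁ A))
            = sphereMeasure n univ ^ (1 / q₂) * (v * (sphereMeasure n univ ^ (1 - 1 / q₁) *
              sphereMeasure n univ ^ (1 / q₁)) *
              (weightedBlissConst n p₁.conjExponent p₂ r * radialNorm n p₁ A)) := by
              rw [← hωsplit]
          _ = _ := by ring

theorem hardyExtremal_mem [NeZero n] {p₁ q₁ p₂ r : ℝ} (hp₁ : 1 < p₁) (hq₁ : 1 < q₁) (hr : 0 < r)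
    (hp : p₂ = p₁ * (r + 1)) :
    hardyExtremal n 𝕜 r ∈ radAngSpace n 𝕜 p₁ q₁ ∧
      radAngNorm p₁ q₁ (hardyExtremal n 𝕜 r) ≠ 0 := by
  have h := radialNorm_extremal_ne (NeZero.ne n) hp₁ hr hp
  have hωt : sphereMeasure n univ ≠ ∞ := measure_ne_top _ _
  have hω0 : sphereMeasure n univ ≠ 0 := by
    have : Nontrivial 𝔼 := Module.nontrivial_of_finrank_pos (R := ℝ)
      (by simpa using Nat.pos_of_ne_zero (NeZero.ne n))
    simp only [sphereMeasure, Ne, Measure.toSphere_eq_zero_iff_finrank, Measure.measure_univ_eq_zero]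
    simpa using NeZero.ne n
  refine ⟨⟨?_, ?_⟩, ?_⟩
  · exact (RCLike.continuous_ofReal.comp
      (continuous_blissTail_norm_pow _ hr)).aestronglyMeasurable
  · rw [radAngNorm_hardyExtremal (by linarith) (by linarith)]
    exact ENNReal.mul_lt_top (ENNReal.rpow_lt_top_of_nonneg (by positivity) hωt) h.2.lt_top
  · rw [radAngNorm_hardyExtremal (by linarith) (by linarith)]
    exact mul_ne_zero (ENNReal.rpow_pos (pos_iff_ne_zero.2 hω0) hωt).ne' h.1

end Radial

/-! ### Identification of the constant and the operator norm -/

/-- The factor `n^(-(1-β/n))` from the substitution joins the power of the unit ball's volume `v`: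
since `ω_n = n v`, only powers of `ω_n` remain. -/
theorem angularConst_mul_weightedBlissConst {n : ℕ} [NeZero n] {β p₁ q₁ p₂ q₂ : ℝ} (hβ : 0 < β)
    (hp₁ : 1 < p₁) (hp₂ : 1 < p₂) :
    angularConst n β q₁ q₂ * weightedBlissConst n p₁.conjExponent p₂ (p₂ * β / n) =
      ENNReal.ofReal (fracHardyConst n β p₁ q₁ p₂ q₂) := by
  have hn : n ≠ 0 := NeZero.ne n
  have hn0 : (0 : ℝ) < n := by exact_mod_cast Nat.pos_of_ne_zero hn
  have hconj := Real.HolderConjugate.conjExponent hp₁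
  have hp'0 := hconj.symm.pos
  set r := p₂ * β / n with hr
  have hr0 : 0 < r := by positivity
  set v := volume.real (Metric.ball (0 : EuclideanSpace ℝ (Fin n)) 1) with hv
  have hv0 : 0 < v := by
    rw [hv, measureReal_def]
    exact ENNReal.toReal_pos (Metric.isOpen_ball.measure_ne_zero _ (by simp)) measure_ball_lt_top.ne
  have hω : sphereArea n = n * v := by
    rw [sphereArea, sphereMeasure, Measure.toSphere_real_apply_univ]; simp [hv]
  have hω0 : 0 < sphereArea n := by rw [hω]; positivity
  have hωe : sphereMeasure n univ = ENNReal.ofReal (sphereArea n) := by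
    rw [sphereArea, ofReal_measureReal]
  have hbeta : eulerBeta (n / (p₂ * β)) (n / (p₂.conjExponent * β)) =
      r * ∫ y in Ioi 0, blissTail r (p₂ / r) y := by
    rw [← eulerBeta_eq_integral_blissTail hr0, hr, Real.conjExponent]
    congr 1
    · field_simp
    · field_simp
  set I := ∫ y in Ioi 0, blissTail r (p₂ / r) y with hI
  have hI0 : 0 ≤ I :=
    setIntegral_nonneg measurableSet_Ioi fun y hy ↦ (blissTail_pos (le_of_lt hy)).le
  have h1 : n / (p₂ * β) * (r * I) = I := by rw [hr]; field_simp
  rw [fracHardyConst, hbeta, h1, angularConst, weightedBlissConst, hωe, ← ENNReal.ofReal_natCast n,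
    ENNReal.ofReal_rpow_of_pos hω0, ENNReal.ofReal_rpow_of_pos hω0, ENNReal.ofReal_rpow_of_pos hn0,
    ← ENNReal.ofReal_mul (p := (n : ℝ) ^ (r - p₂)) (by positivity), ← hI, ← hv,
    ENNReal.ofReal_rpow_of_nonneg (by positivity) (by positivity), ← ENNReal.ofReal_mul (by positivity), ← ENNReal.ofReal_mul (by positivity),
    ← ENNReal.ofReal_mul (by positivity)]
  congr 1
  -- The factor `(p₁'/p₂)^(1/p₂)` occurs on both sides; the rest is a comparison of exponents.
  rw [Real.mul_rpow (by positivity) (by positivity), Real.mul_rpow (by positivity) (by positivity),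
    ← Real.rpow_mul hI0, ← Real.rpow_mul hn0.le]
  have h2 : -r * (1 / p₂) = -(β / n) := by rw [hr]; field_simp
  have h3 : (r - p₂) * (1 / p₂) = -(1 - β / n) := by rw [hr]; field_simp; ring
  rw [h2, h3]
  have h4 : sphereArea n ^ (1 / q₂) * (v ^ (-(1 - β / n)) * sphereArea n ^ (1 - 1 / q₁)) *
      (n : ℝ) ^ (-(1 - β / n)) = sphereArea n ^ (1 / q₂ - 1 / q₁ + β / n) := by
    calc _ = sphereArea n ^ (1 / q₂) * sphereArea n ^ (1 - 1 / q₁) *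
          ((n : ℝ) ^ (-(1 - β / n)) * v ^ (-(1 - β / n))) := by ring
      _ = _ := by
        rw [← Real.mul_rpow hn0.le hv0.le, ← hω, ← Real.rpow_add hω0, ← Real.rpow_add hω0]
        congr 1; ring
  rw [← h4]
  ring

/-- Stated for any class containing the extremal, so that the whole space and the nonnegative
functions are covered together. -/
theorem radAngOpNorm_fracHardy {n : ℕ} [NeZero n] {𝕜 : Type*} [RCLike 𝕜] {β p₁ q₁ p₂ q₂ : ℝ}
    (hβ : 0 < β) (hp₁ : 1 < p₁) (hq₁ : 1 < q₁) (hp₂ : 1 < p₂) (hq₂ : 1 < q₂)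
    (hp : p₂ = p₁ * (p₂ * β / n + 1)) {D : Set (EuclideanSpace ℝ (Fin n) → 𝕜)}
    (hD : D ⊆ radAngSpace n 𝕜 p₁ q₁) (hmem : hardyExtremal n 𝕜 (p₂ * β / n) ∈ D) :
    radAngOpNorm D (fracHardy β) p₁ q₁ p₂ q₂ =
      ENNReal.ofReal (fracHardyConst n β p₁ q₁ p₂ q₂) := by
  have hn0 : (0 : ℝ) < n := by exact_mod_cast Nat.pos_of_ne_zero (NeZero.ne n)
  rw [← angularConst_mul_weightedBlissConst hβ hp₁ hp₂]
  refine le_antisymm (sInf_le fun f hf ↦ ?_) (le_sInf fun C hC ↦ ?_)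
  · exact radAngNorm_fracHardy_le hβ hp₁ hq₁ hp₂ hq₂ hp (hD hf).1
  · have h1 := hC _ hmem
    obtain ⟨h2, h3⟩ := hardyExtremal_mem (n := n) (𝕜 := 𝕜) hp₁ hq₁
      (show 0 < p₂ * β / n by positivity) hp
    rw [radAngNorm_fracHardy_hardyExtremal hβ hp₁ hq₁ hp₂ hq₂ hp] at h1
    -- The norm of the extremal is neither zero nor infinite, so it cancels.
    exact (ENNReal.mul_le_mul_iff_left h3 h2.2.ne).1 h1

theorem theorem4p1 {𝕜 : Type*} [RCLike 𝕜] (n : ℕ) (β p₁ q₁ p₂ q₂ : ℝ)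
    (hβ : 0 < β) (hβn : β < n)
    (hp₁ : 1 < p₁) (hq₁ : 1 < q₁) (hp₂ : 1 < p₂) (hq₂ : 1 < q₂)
    (hp : 1 / p₁ - 1 / p₂ = β / n) :
    (∀ f ∈ radAngSpace n 𝕜 p₁ q₁, fracHardy β f ∈ radAngSpace n 𝕜 p₂ q₂) ∧
    radAngOpNorm (radAngSpace n 𝕜 p₁ q₁) (fracHardy β) p₁ q₁ p₂ q₂ =
      ENNReal.ofReal (fracHardyConst n β p₁ q₁ p₂ q₂) ∧
    radAngOpNorm {f | f ∈ radAngSpace n ℝ p₁ q₁ ∧ ∀ x, 0 ≤ f x} (fracHardy β) p₁ q₁ p₂ q₂ =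
      ENNReal.ofReal (fracHardyConst n β p₁ q₁ p₂ q₂) := by
  have hn0 : (0 : ℝ) < n := hβ.trans hβn
  have : NeZero n := ⟨by rintro rfl; simp at hn0⟩
  have hr : 0 < p₂ * β / n := by positivity
  -- The scaling relation multiplied by `p₂` reads `p₂/p₁ = 1 + p₂β/n`, Bliss's condition `q =
  -- p(r+1)`.
  have hpq : p₂ = p₁ * (p₂ * β / n + 1) := by
    rw [mul_div_assoc, ← hp]
    field_simp
    ring
  refine ⟨fun f hf ↦ ⟨aestronglyMeasurable_fracHardy β hf.1, ?_⟩,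
    radAngOpNorm_fracHardy hβ hp₁ hq₁ hp₂ hq₂ hpq subset_rfl (hardyExtremal_mem hp₁ hq₁ hr hpq).1,
    radAngOpNorm_fracHardy hβ hp₁ hq₁ hp₂ hq₂ hpq (fun f hf ↦ hf.1)
      ⟨(hardyExtremal_mem hp₁ hq₁ hr hpq).1, fun x ↦ ?_⟩⟩
  · refine (radAngNorm_fracHardy_le hβ hp₁ hq₁ hp₂ hq₂ hpq hf.1).trans_lt ?_
    rw [angularConst_mul_weightedBlissConst hβ hp₁ hp₂]
    exact ENNReal.mul_lt_top ENNReal.ofReal_lt_top hf.2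
  · exact (blissTail_pos (by positivity)).le
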